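/- Let $n\ge 0$, $d\ge 2$, $r\ge 1$ be integers and write $[n]=\{1,\dots,n\}$. The oracles are $n$ unitary gates $U_1,\dots,U_n$, each acting on a register of $r$ wires of dimension $d$ (qubits for $d=2$). Consider circuits acting on a control register with orthonormal basis $|\sigma\rangle$, $\sigma$ ranging over the permutations of $[n]$, and on $k=r+m$ target wires of dimension $d$, namely $r$ data wires and some number $m\ge 0$ of ancillary wires which start in a fixed state $\chi_0$. A circuit is a finite sequence of gates, each of which is either (a) a rewiring gate $R|\sigma,x_1,\dots,x_k\rangle=|\sigma,x_{\tau_1},\dots,x_{\tau_k}\rangle$, where $\tau=\tau(\sigma)$ is a permutation of $[k]$ that depends on $\sigma$, or (b) a call to one of the oracles $U_j$, applied to $r$ distinct target wires (and the identity elsewhere). Such a circuit solves the unitary permutation problem $\mathsf{UP}_n$ if for all unitaries $U_1,\dots,U_n$, all permutations $\sigma$ of $[n]$ and all states $\varphi$ of the data wires, there is a state $\chi$ of the ancillary wires such that the circuit maps $|\sigma\rangle\otimes\varphi\otimes\chi_0$ to $|\sigma\rangle\otimes U_{\sigma(n)}\cdots U_{\sigma(1)}\varphi\otimes\chi$ (a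 global phase being absorbed in $\chi$). Then for every $\varepsilon>0$ there is a function $f:\mathbb N\to\mathbb R$ with $f(n)=o(n^{7/4+\varepsilon})$ as $n\to\infty$, depending only on $\varepsilon$, such that for all $n,d,r$ as above every such circuit which solves $\mathsf{UP}_n$ contains at least $n^2-f(n)$ oracle calls. -/

import Mathlib

open Filter Asymptotics
open scoped Matrix

namespace UnitaryPermutation

/-- Vectors in computational-basis coordinates: `ψ b` is the amplitude of the basis vector `b`.
`IsState ψ` says that `ψ` is a quantum state, that is, a unit vector of `ℂ^B`. -/
def IsState {B : Type} [Fintype B] (ψ : B → ℂ) : Prop :=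
  ∑ b, ‖ψ b‖ ^ 2 = 1

/-- The target wires of a circuit: `r` data wires and `m` ancillary wires. -/
abbrev Wire (r m : ℕ) : Type := Fin r ⊕ Fin m

/-- Basis states `|σ, x⟩` of the whole system: a permutation `σ` of `[n]` in the control register
and a value in `Fin d` on each target wire (`d = 2` for qubits). -/
abbrev Basis (n d r m : ℕ) : Type := Equiv.Perm (Fin n) × (Wire r m → Fin d)

/-- An `n`-tuple of oracles: unitary gates `U_1, …, U_n`, each acting on `r` wires of
dimension `d`. -/
abbrev Oracles (n d r : ℕ) : Type :=
  Fin n → Matrix.unitaryGroup (Fin r → Fin d) ℂ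

/-- The gates allowed in a circuit. -/
inductive Gate (n r m : ℕ) : Type
  /-- A rewiring gate: a permutation of the target wires that depends on the permutation held in
  the control register. -/
  | rewire (τ : Equiv.Perm (Fin n) → Equiv.Perm (Wire r m))
  /-- A call to `U_j` on the `r` distinct target wires `e 0, …, e (r - 1)`. -/
  | call (j : Fin n) (e : Fin r ↪ Wire r m)

/-- The matrix of the rewiring gate `|σ, x_1, …, x_k⟩ ↦ |σ, x_{τ_1}, …, x_{τ_k}⟩`, where the
permutation `τ` of the wires depends on `σ`. -/
def rewireMatrix {n d r m : ℕ} (τ : Equiv.Perm (Fin n) → Equiv.Perm (Wire r m)) :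
    Matrix (Basis n d r m) (Basis n d r m) ℂ :=
  Matrix.of fun b a => if b = (a.1, fun w => a.2 (τ a.1 w)) then 1 else 0

open Classical in
/-- The matrix of the unitary `V` applied to the wires `e 0, …, e (r - 1)`, tensored with the
identity on the control register and on all other wires. -/
noncomputable def applyMatrix {n d r m : ℕ} (V : Matrix (Fin r → Fin d) (Fin r → Fin d) ℂ)
    (e : Fin r ↪ Wire r m) : Matrix (Basis n d r m) (Basis n d r m) ℂ :=
  Matrix.of fun b a =>
    if b.1 = a.1 ∧ ∀ w, w ∉ Set.range e → b.2 w = a.2 w then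
      V (fun i => b.2 (e i)) (fun i => a.2 (e i))
    else 0

/-- The matrix of a gate, given the oracles. -/
noncomputable def Gate.matrix {n d r m : ℕ} (U : Oracles n d r) :
    Gate n r m → Matrix (Basis n d r m) (Basis n d r m) ℂ
  | .rewire τ => rewireMatrix τ
  | .call j e => applyMatrix (U j : Matrix (Fin r → Fin d) (Fin r → Fin d) ℂ) e

/-- The number of oracle calls made by a gate. -/
def Gate.calls {n r m : ℕ} : Gate n r m → ℕ
  | .rewire _ => 0
  | .call _ _ => 1

/-- A circuit for `n` oracles acting on `r` wires of dimension `d`, composed of rewiring gates and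
oracle calls: some number `m` of ancillary wires, a fixed initial state of these, and a finite
sequence of gates (the head of the list is applied first). -/
structure Circuit (n d r : ℕ) where
  m : ℕ
  ancilla : (Fin m → Fin d) → ℂ
  isState_ancilla : IsState ancilla
  gates : List (Gate n r m)

/-- The number of oracle calls of a circuit. -/
def Circuit.calls {n d r : ℕ} (C : Circuit n d r) : ℕ :=
  (C.gates.map Gate.calls).sum

/-- The vector `|σ⟩ ⊗ φ ⊗ χ`. -/
def tensorState {n d r m : ℕ} (σ : Equiv.Perm (Fin n)) (φ : (Fin r → Fin d) → ℂ)
    (χ : (Fin m → Fin d) → ℂ) : Basis n d r m → ℂ :=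
  fun b => if b.1 = σ then φ (fun i => b.2 (Sum.inl i)) * χ (fun i => b.2 (Sum.inr i)) else 0

/-- The final vector of the circuit on the initial vector `ψ`, when run with the oracles `U`. -/
noncomputable def Circuit.run {n d r : ℕ} (C : Circuit n d r) (U : Oracles n d r)
    (ψ : Basis n d r C.m → ℂ) : Basis n d r C.m → ℂ :=
  C.gates.foldl (fun v g => g.matrix U *ᵥ v) ψ

/-- The product `U_{σ(n)} ⋯ U_{σ(1)}`. -/
noncomputable def orderedProduct {n d r : ℕ} (U : Oracles n d r) (σ : Equiv.Perm (Fin n)) :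
    Matrix.unitaryGroup (Fin r → Fin d) ℂ :=
  (List.ofFn fun i => U (σ i)).reverse.prod

/-- The circuit solves the unitary permutation problem: for all unitaries `U_1, …, U_n`, every
permutation `σ` and every data state `φ`, it maps `|σ⟩ ⊗ φ ⊗ ancilla` to
`|σ⟩ ⊗ U_{σ(n)} ⋯ U_{σ(1)} φ ⊗ χ` for some state `χ` of the ancillary wires.
A global phase is absorbed in `χ`. -/
def Circuit.SolvesUP {n d r : ℕ} (C : Circuit n d r) : Prop :=
  ∀ (U : Oracles n d r) (σ : Equiv.Perm (Fin n)) (φ : (Fin r → Fin d) → ℂ), IsState φ →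
    ∃ χ : (Fin C.m → Fin d) → ℂ, IsState χ ∧
      C.run U (tensorState σ φ C.ancilla) =
        tensorState σ
          ((orderedProduct U σ : Matrix (Fin r → Fin d) (Fin r → Fin d) ℂ) *ᵥ φ) χ

end UnitaryPermutation

namespace UnitaryPermutation

/-! The called oracles, listed in order, form a word over `[n]` whose length is the number of calls.
Two independent facts give the bound: the word contains every permutation as a subsequence, and any
such word has length at least `n ^ 2 - o(n ^ (7 / 4 + ε))`.

For the first fact (`ofFn_sublist_calledOracles`), let each oracle act by a reflection on a single
one of its wires. For fixed `σ`, an output data wire is then fed by one input wire, through a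
subsequence `l` of the calls. A reflection squares to a scalar, so `l` can be reduced by cancelling
equal neighbours. The reflections depend on a real parameter `s`; continued to `s = i` they become
rank-one nilpotents, and a reduced product applied to the start vector then reveals the factor
applied last. Peeling factors off in this way shows that the reduced form of `l` is the word of `σ`.
Cancelling only deletes letters, so `σ` is a subsequence of `l`.

For the second fact, suppose that `s` is too short. Give a letter the potential `1 / (count + K)`,
where `count` refers to the part of `s` still ahead. By Cauchy–Schwarz the total `Ψ` exceeds `1`.
Cut `s` into pieces and cross each by a word that is not a subsequence of it. With letters weighted
by potential, the average price of crossing a piece telescopes to about its increase of potential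
divided by `Ψ`, which is less than the increase (`exists_word_of_potential`). Hence the used letters
can be discarded and the potential stays above `1` to the end of `s`. The crossing words together
have distinct letters and do not embed in `s` (`exists_nodup_not_sublist`), yet they extend to a
permutation.

Letters must not repeat inside one crossing word either. Therefore `budget` asks that at every step
letters of total weight `ω` be affordable, which leaves room to avoid those already used;
`budget_le` shows that this robustness costs little when few distinct prices occur. -/

theorem sublist_of_cons_sublist_append {α : Type*} {l t w : List α} {b : α} (hb : b ∉ l)
    (h : (b :: w).Sublist (l ++ b :: t)) : w.Sublist t := by
  induction l with
  | nil => simpa using h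
  | cons x l ih =>
    rw [List.mem_cons, not_or] at hb
    rw [List.cons_append] at h
    cases h with
    | cons _ h => exact ih hb.2 h
    | cons_cons => exact absurd rfl hb.1

/-! ### Robust budgets for crossing a word -/

section Quantile

variable {α : Type*} [Fintype α]

/-- The letters `b` whose cost plus continuation value is at most `v`. -/
def affordable (c g : α → ℕ) (v : ℕ) : Finset α :=
  Finset.univ.filter fun b => c b + g b ≤ v

open Classical in
/-- The least budget for which letters of total weight at least `ω` are affordable. -/
noncomputable def quantile (y : α → ℝ) (c : α → ℕ) (ω : ℝ) (g : α → ℕ) : ℕ :=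
  if h : ∃ v, ω ≤ ∑ b ∈ affordable c g v, y b then Nat.find h else 0

variable {y : α → ℝ} {c : α → ℕ} {ω : ℝ}

theorem exists_affordable (hy1 : ∑ b, y b = 1) (hω : ω ≤ 1) (g : α → ℕ) :
    ∃ v, ω ≤ ∑ b ∈ affordable c g v, y b := by
  refine ⟨∑ b, (c b + g b), ?_⟩
  have : affordable c g (∑ b, (c b + g b)) = Finset.univ := by
    ext b
    simp only [affordable, Finset.mem_filter, Finset.mem_univ, true_and, iff_true]
    exact Finset.single_le_sum (f := fun b => c b + g b) (fun _ _ => Nat.zero_le _)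
      (Finset.mem_univ b)
  rw [this, hy1]
  exact hω

theorem le_sum_affordable_quantile (hy1 : ∑ b, y b = 1) (hω : ω ≤ 1) (g : α → ℕ) :
    ω ≤ ∑ b ∈ affordable c g (quantile y c ω g), y b := by
  have h := exists_affordable (c := c) hy1 hω g
  rw [quantile, dif_pos h]
  exact Nat.find_spec h

theorem quantile_le {g : α → ℕ} {v : ℕ} (hv : ω ≤ ∑ b ∈ affordable c g v, y b) :
    quantile y c ω g ≤ v := by
  rw [quantile, dif_pos ⟨v, hv⟩]
  exact Nat.find_min' _ hv

theorem quantile_mono (hy : ∀ b, 0 ≤ y b) (hy1 : ∑ b, y b = 1) (hω : ω ≤ 1) {g g' : α → ℕ}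
    (h : g ≤ g') : quantile y c ω g ≤ quantile y c ω g' := by
  refine quantile_le ((le_sum_affordable_quantile (c := c) hy1 hω g').trans ?_)
  refine Finset.sum_le_sum_of_subset_of_nonneg ?_ fun b _ _ => hy b
  intro b hb
  simp only [affordable, Finset.mem_filter, Finset.mem_univ, true_and] at hb ⊢
  exact (Nat.add_le_add_left (h b) _).trans hb

variable [DecidableEq α]

/-- `contValue y c ω t b` is the budget needed after the next occurrence of `b` in `t`; it is `0`
if `b` does not occur. -/
noncomputable def contValue (y : α → ℝ) (c : α → ℕ) (ω : ℝ) : List α → α → ℕ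
  | [] => 0
  | x :: t => Function.update (contValue y c ω t) x (quantile y c ω (contValue y c ω t))

/-- The robust budget for a word that is not a subsequence of `t`. -/
noncomputable def budget (y : α → ℝ) (c : α → ℕ) (ω : ℝ) (t : List α) : ℕ :=
  quantile y c ω (contValue y c ω t)

theorem contValue_cons (x : α) (t : List α) :
    contValue y c ω (x :: t) = Function.update (contValue y c ω t) x (budget y c ω t) := rfl

/-- Each update replaces a value by a budget that dominates it, so `contValue` only grows as the
word is extended to the left; the quantile, being monotone, grows with it. -/
theorem contValue_le_budget (hy : ∀ b, 0 ≤ y b) (hy1 : ∑ b, y b = 1) (hω : ω ≤ 1) (t : List α)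
    (b : α) : contValue y c ω t b ≤ budget y c ω t := by
  induction t generalizing b with
  | nil => simp [contValue]
  | cons x t ih =>
    have hle : contValue y c ω t ≤ contValue y c ω (x :: t) := by
      intro a
      rw [contValue_cons]
      by_cases h : a = x
      · subst h; simpa using ih a
      · simp [h]
    have hq : budget y c ω t ≤ budget y c ω (x :: t) := quantile_mono hy hy1 hω hle
    rw [contValue_cons]
    by_cases h : b = x
    · subst h; simpa using hq
    · simpa [h] using (ih b).trans hq

theorem contValue_le_cons (hy : ∀ b, 0 ≤ y b) (hy1 : ∑ b, y b = 1) (hω : ω ≤ 1) (x : α)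
    (t : List α) : contValue y c ω t ≤ contValue y c ω (x :: t) := by
  intro a
  rw [contValue_cons]
  by_cases h : a = x
  · subst h; simpa using contValue_le_budget hy hy1 hω t a
  · simp [h]

theorem contValue_mono (hy : ∀ b, 0 ≤ y b) (hy1 : ∑ b, y b = 1) (hω : ω ≤ 1) {s t : List α}
    (h : s <:+ t) : contValue y c ω s ≤ contValue y c ω t := by
  induction t with
  | nil => rw [List.suffix_nil.1 h]
  | cons x t ih =>
    rcases List.suffix_cons_iff.1 h with rfl | h
    · exact le_rfl
    · exact (ih h).trans (contValue_le_cons hy hy1 hω x t)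

/-- The total weighted surplus of the jumps from an occurrence of a letter in `t` to the next. -/
noncomputable def surplus (y : α → ℝ) (c : α → ℕ) (ω : ℝ) : List α → α → ℕ
  | [], _ => 0
  | x :: t, b => surplus y c ω t b +
      if b = x then budget y c ω t - contValue y c ω t x - c x else 0

/-- The value at `b` changes only at occurrences of `b`, and each of these raises it by at most `c
b` plus the surplus of that jump. -/
theorem sum_contValue_le (hy : ∀ b, 0 ≤ y b) (t : List α) :
    ∑ b, y b * contValue y c ω t b ≤
      ∑ b, y b * (c b * t.count b) + ∑ b, y b * surplus y c ω t b := by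
  rw [← Finset.sum_add_distrib]
  refine Finset.sum_le_sum fun b _ => ?_
  rw [← mul_add]
  refine mul_le_mul_of_nonneg_left ?_ (hy b)
  induction t with
  | nil => simp [contValue, surplus]
  | cons x t ih =>
    rw [contValue_cons, surplus, List.count_cons]
    by_cases h : b = x
    · subst h
      have : budget y c ω t ≤ contValue y c ω t b + c b +
          (budget y c ω t - contValue y c ω t b - c b) := by omega
      have h2 : (budget y c ω t : ℝ) ≤ contValue y c ω t b + c b +
          ((budget y c ω t - contValue y c ω t b - c b : ℕ) : ℝ) := by exact_mod_cast this
      simp only [Function.update_self, beq_self_eq_true, if_true, Nat.cast_add, Nat.cast_one]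
      linarith
    · have h' : ¬ x = b := fun e => h e.symm
      simpa [h, h'] using ih

/-- The letters with a jump inside `T` that passes the level `u` with surplus. -/
def levelSet (y : α → ℝ) (c : α → ℕ) (ω : ℝ) (T : List α) (u : ℕ) : Set α :=
  {b | ∃ t, t <:+ T ∧ contValue y c ω t b ≤ u ∧ u + c b < budget y c ω t}

-- The successive jumps of one letter run over disjoint intervals of levels, since a jump starts no
-- lower than the previous one ended. The surplus can thus be counted as a set of levels.
open Classical in
theorem surplus_add_le_card (hy : ∀ b, 0 ≤ y b) (hy1 : ∑ b, y b = 1) (hω : ω ≤ 1)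
    {T t : List α} (h : t <:+ T) {b : α}
    (hb : surplus y c ω t b ≤
      ((Finset.range (contValue y c ω t b)).filter fun u => b ∈ levelSet y c ω T u).card) :
    surplus y c ω t b + (budget y c ω t - contValue y c ω t b - c b) ≤
      ((Finset.range (budget y c ω t)).filter fun u => b ∈ levelSet y c ω T u).card := by
  have hAB := contValue_le_budget (c := c) hy hy1 hω t b
  have hsub : ((Finset.range (contValue y c ω t b)).filter fun u => b ∈ levelSet y c ω T u) ∪
      Finset.Ico (contValue y c ω t b) (budget y c ω t - c b) ⊆
      (Finset.range (budget y c ω t)).filter fun u => b ∈ levelSet y c ω T u := by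
    intro u hu
    simp only [Finset.mem_union, Finset.mem_filter, Finset.mem_range, Finset.mem_Ico] at hu ⊢
    rcases hu with ⟨h1, h2⟩ | ⟨h1, h2⟩
    · exact ⟨by omega, h2⟩
    · exact ⟨by omega, t, h, h1, by omega⟩
  have hdisj : Disjoint
      ((Finset.range (contValue y c ω t b)).filter fun u => b ∈ levelSet y c ω T u)
      (Finset.Ico (contValue y c ω t b) (budget y c ω t - c b)) := by
    rw [Finset.disjoint_left]
    intro u hu hu'
    simp only [Finset.mem_filter, Finset.mem_range, Finset.mem_Ico] at hu hu'
    omega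
  have := Finset.card_le_card hsub
  rw [Finset.card_union_of_disjoint hdisj, Nat.card_Ico] at this
  omega

open Classical in
theorem surplus_le_card (hy : ∀ b, 0 ≤ y b) (hy1 : ∑ b, y b = 1) (hω : ω ≤ 1)
    {T t : List α} (h : t <:+ T) (b : α) :
    surplus y c ω t b ≤
      ((Finset.range (contValue y c ω t b)).filter fun u => b ∈ levelSet y c ω T u).card := by
  induction t with
  | nil => simp [surplus]
  | cons x t ih =>
    have ht : t <:+ T := (List.suffix_cons x t).trans h
    specialize ih ht
    rw [surplus, contValue_cons]
    by_cases hb : b = x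
    · subst hb
      simpa using surplus_add_le_card hy hy1 hω ht ih
    · simpa [hb] using ih

-- Take the shortest suffix `t` with budget above `u + γ`. By monotonicity all letters in question
-- have `contValue` at most `u` already at `t`, so they are affordable there for `u + γ`; minimality
-- of the quantile bounds their weight by `ω`.
open Classical in
theorem sum_levelSet_le (hy : ∀ b, 0 ≤ y b) (hy1 : ∑ b, y b = 1) (hω0 : 0 ≤ ω) (hω : ω ≤ 1)
    (T : List α) (u γ : ℕ) :
    ∑ b with b ∈ levelSet y c ω T u ∧ c b = γ, y b ≤ ω := by
  by_cases hex : ∃ k, ∃ t, t <:+ T ∧ u + γ < budget y c ω t ∧ t.length = k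
  · obtain ⟨t, ht, hut, hlen⟩ := Nat.find_spec hex
    have hlt : ∑ b ∈ affordable c (contValue y c ω t) (u + γ), y b < ω := by
      by_contra hcon
      exact absurd (quantile_le (not_lt.1 hcon)) (not_le.2 hut)
    refine le_trans (Finset.sum_le_sum_of_subset_of_nonneg ?_ fun b _ _ => hy b) hlt.le
    intro b hb
    simp only [affordable, Finset.mem_filter, Finset.mem_univ, true_and] at hb ⊢
    obtain ⟨⟨t', ht', h1, h2⟩, rfl⟩ := hb
    have hle : t.length ≤ t'.length := by
      rw [hlen]
      exact Nat.find_min' hex ⟨t', ht', h2, rfl⟩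
    have : contValue y c ω t b ≤ contValue y c ω t' b :=
      contValue_mono hy hy1 hω (List.suffix_of_suffix_length_le ht ht' hle) b
    omega
  · rw [Finset.filter_false_of_mem, Finset.sum_empty]
    · exact hω0
    · rintro b - ⟨⟨t, ht, -, h2⟩, rfl⟩
      exact hex ⟨_, t, ht, h2, rfl⟩

/-- The robust budget is at most the average cost of crossing `T`, up to a small factor. -/
theorem budget_le (hy : ∀ b, 0 ≤ y b) (hy1 : ∑ b, y b = 1) (hω0 : 0 ≤ ω) (hω : ω ≤ 1)
    (T : List α) :
    (budget y c ω T : ℝ) ≤ ∑ b, y b * (c b * (T.count b + 1)) +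
      (Finset.univ.image c).card * ω * budget y c ω T := by
  classical
  -- Besides the jumps inside `T` there is a last one, from `contValue y c ω T b` to the budget of
  -- `T` itself; it accounts for the `+ 1` in the bound.
  set E : α → ℕ := fun b => surplus y c ω T b + (budget y c ω T - contValue y c ω T b - c b)
    with hE
  have h1 : (budget y c ω T : ℝ) ≤ ∑ b, y b * (c b * (T.count b + 1)) + ∑ b, y b * E b := by
    have hs := sum_contValue_le (c := c) (ω := ω) hy T
    have hb : (budget y c ω T : ℝ) = ∑ b, y b * budget y c ω T := by
      rw [← Finset.sum_mul, hy1, one_mul]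
    have h2 : ∑ b, y b * (budget y c ω T : ℝ) ≤ ∑ b, y b * contValue y c ω T b +
        ∑ b, y b * c b +
        ∑ b, y b * ((budget y c ω T - contValue y c ω T b - c b : ℕ) : ℝ) := by
      rw [← Finset.sum_add_distrib, ← Finset.sum_add_distrib]
      refine Finset.sum_le_sum fun b _ => ?_
      rw [← mul_add, ← mul_add]
      refine mul_le_mul_of_nonneg_left ?_ (hy b)
      have : budget y c ω T ≤ contValue y c ω T b + c b +
        (budget y c ω T - contValue y c ω T b - c b) := by omega
      exact_mod_cast this
    rw [hb]
    refine h2.trans ?_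
    have h3 : ∑ b, y b * ((c b : ℝ) * (T.count b + 1)) =
        ∑ b, y b * ((c b : ℝ) * T.count b) + ∑ b, y b * c b := by
      rw [← Finset.sum_add_distrib]
      exact Finset.sum_congr rfl fun b _ => by ring
    have h4 : ∑ b, y b * (E b : ℝ) = ∑ b, y b * (surplus y c ω T b : ℝ) +
        ∑ b, y b * ((budget y c ω T - contValue y c ω T b - c b : ℕ) : ℝ) := by
      rw [← Finset.sum_add_distrib]
      exact Finset.sum_congr rfl fun b _ => by simp only [hE, Nat.cast_add]; ring
    rw [h3, h4]
    linarith
  refine h1.trans (add_le_add_right ?_ _)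
  have h2 : ∀ b, (E b : ℝ) ≤ ∑ u ∈ Finset.range (budget y c ω T),
      if b ∈ levelSet y c ω T u then (1 : ℝ) else 0 := by
    intro b
    have := surplus_add_le_card hy hy1 hω (List.suffix_refl T)
      (surplus_le_card (c := c) hy hy1 hω (List.suffix_refl T) b)
    rw [Finset.sum_boole]
    exact_mod_cast this
  calc ∑ b, y b * (E b : ℝ)
      ≤ ∑ b, ∑ u ∈ Finset.range (budget y c ω T),
          if b ∈ levelSet y c ω T u then y b else 0 := by
        refine Finset.sum_le_sum fun b _ => ?_
        refine (mul_le_mul_of_nonneg_left (h2 b) (hy b)).trans ?_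
        rw [Finset.mul_sum]
        simp
    _ = ∑ u ∈ Finset.range (budget y c ω T), ∑ γ ∈ Finset.univ.image c,
          ∑ b with b ∈ levelSet y c ω T u ∧ c b = γ, y b := by
        rw [Finset.sum_comm]
        refine Finset.sum_congr rfl fun u _ => ?_
        rw [← Finset.sum_filter, ← Finset.sum_fiberwise_of_maps_to
          (g := c) (t := Finset.univ.image c) (fun b _ => Finset.mem_image_of_mem c (Finset.mem_univ b))]
        refine Finset.sum_congr rfl fun γ _ => ?_
        rw [Finset.filter_filter]
    _ ≤ ∑ u ∈ Finset.range (budget y c ω T), ∑ γ ∈ Finset.univ.image c, ω :=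
        Finset.sum_le_sum fun u _ => Finset.sum_le_sum fun γ _ =>
          sum_levelSet_le hy hy1 hω0 hω T u γ
    _ = (Finset.univ.image c).card * ω * budget y c ω T := by
        simp only [Finset.sum_const, Finset.card_range, nsmul_eq_mul]
        ring

theorem contValue_append_cons {l t : List α} {b : α} (h : b ∉ l) :
    contValue y c ω (l ++ b :: t) b = budget y c ω t := by
  induction l with
  | nil => simp [contValue_cons]
  | cons x l ih =>
    rw [List.mem_cons, not_or] at h
    rw [List.cons_append, contValue_cons, Function.update_of_ne h.1, ih h.2]

/-- Within the robust budget there is a word of distinct letters, avoiding a set `H` of small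
weight, that is not a subsequence of `t`. -/
theorem exists_word_of_budget (hy : ∀ b, 0 ≤ y b) (hy1 : ∑ b, y b = 1) (hω : ω ≤ 1) {κ : ℝ} (hκ : 0 ≤ κ)
    (hyc : ∀ b, y b ≤ κ * c b) (t : List α) (H : Finset α)
    (hH : ∑ b ∈ H, y b + κ * budget y c ω t < ω) :
    ∃ w : List α, w.Nodup ∧ (∀ b ∈ w, b ∉ H) ∧ ¬ w.Sublist t ∧ (w.map c).sum ≤ budget y c ω t := by
  induction hn : t.length using Nat.strong_induction_on generalizing t H with
  | _ n ih =>
  subst hn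
  have hq := le_sum_affordable_quantile (c := c) hy1 hω (contValue y c ω t)
  change ω ≤ ∑ b ∈ affordable c _ (budget y c ω t), y b at hq
  obtain ⟨b, hbA, hbH⟩ : ∃ b ∈ affordable c (contValue y c ω t) (budget y c ω t),
      b ∉ H := by
    by_contra! hcon
    have : ∑ b ∈ affordable c (contValue y c ω t) (budget y c ω t), y b ≤ ∑ b ∈ H, y b :=
      Finset.sum_le_sum_of_subset_of_nonneg hcon fun b _ _ => hy b
    have h0 : 0 ≤ κ * (budget y c ω t : ℝ) := by positivity
    linarith
  have hb : c b + contValue y c ω t b ≤ budget y c ω t := by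
    simpa [affordable] using hbA
  by_cases hbt : b ∈ t
  · obtain ⟨l, t', rfl, hbl⟩ := List.eq_append_cons_of_mem hbt
    rw [contValue_append_cons hbl] at hb
    have hb' : (c b : ℝ) + budget y c ω t' ≤ budget y c ω (l ++ b :: t') := by exact_mod_cast hb
    have hb2 := mul_le_mul_of_nonneg_left hb' hκ
    -- Forbidding `b` from now on adds at most `κ * c b` to the weight of `H`; the budget drops by
    -- at least `c b`, so the hypothesis on `H` persists.
    obtain ⟨w, hw1, hw2, hw3, hw4⟩ := ih t'.length (by simp; omega) t' (insert b H)
      (by rw [Finset.sum_insert hbH]; have := hyc b; linarith) rfl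
    refine ⟨b :: w, ?_, ?_, ?_, ?_⟩
    · refine List.nodup_cons.2 ⟨fun h => hw2 b h (Finset.mem_insert_self _ _), hw1⟩
    · intro a ha
      rcases List.mem_cons.1 ha with rfl | ha
      · exact hbH
      · exact fun h => hw2 a ha (Finset.mem_insert_of_mem h)
    · exact fun h => hw3 (sublist_of_cons_sublist_append hbl h)
    · simp only [List.map_cons, List.sum_cons]; omega
  · refine ⟨[b], by simp, by simpa using hbH, by simpa using hbt, ?_⟩
    simp only [List.map_cons, List.map_nil, List.sum_cons, List.sum_nil]
    omega

end Quantile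

theorem not_append_sublist_append {α : Type*} {w w' s s' : List α} (h : ¬ w.Sublist s)
    (h' : ¬ w'.Sublist s') : ¬ (w ++ w').Sublist (s ++ s') := by
  intro hs
  obtain ⟨l₁, l₂, he, h1, h2⟩ := List.sublist_append_iff.1 hs
  rcases List.append_eq_append_iff.1 he with ⟨a, rfl, -⟩ | ⟨a, -, rfl⟩
  · exact h ((List.sublist_append_left _ _).trans h1)
  · exact h' ((List.sublist_append_right _ _).trans h2)

/-! ### Words containing all permutations are long -/

section Supersequence

/-- A decreasing integer approximation of `g ↦ Λ / g` on `[1, M]` with few values. -/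
theorem exists_cost_grid {δ : ℝ} (hδ : 0 < δ) (hδ1 : δ ≤ 1) (M : ℕ) (hM : 1 ≤ M) :
    ∃ (r : ℕ → ℕ) (Λ : ℝ), 0 < Λ ∧
      (∀ g, 1 ≤ g → g ≤ M → Λ / g ≤ r g ∧ (r g : ℝ) ≤ (1 + 2 * δ) * (Λ / g)) ∧
      (((Finset.Icc 1 M).image r).card : ℝ) ≤ 2 * Real.log M / δ + 1 := by
  have hlog : δ / 2 ≤ Real.log (1 + δ) := by
    refine le_trans ?_ (Real.le_log_one_add_of_nonneg hδ.le)
    rw [div_le_div_iff₀ (by norm_num) (by linarith)]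
    nlinarith
  have hlog0 : 0 < Real.log (1 + δ) := by linarith
  have hM0 : (1 : ℝ) ≤ M := by exact_mod_cast hM
  set i : ℕ → ℕ := fun g => ⌊Real.log g / Real.log (1 + δ)⌋₊ with hi
  -- So large that `Λ / g ≥ 1 / δ` for `g ≤ M`: rounding up to an integer then costs at most another
  -- `δ * (Λ / g)`.
  set Λ : ℝ := M / δ with hΛ
  have hΛ0 : 0 < Λ := by positivity
  refine ⟨fun g => ⌈Λ / (1 + δ) ^ i g⌉₊, Λ, hΛ0, ?_, ?_⟩
  · intro g hg hgM
    have hg0 : (1 : ℝ) ≤ g := by exact_mod_cast hg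
    have hgM' : (g : ℝ) ≤ M := by exact_mod_cast hgM
    have hlg : 0 ≤ Real.log g := Real.log_nonneg hg0
    have h1 : (1 + δ) ^ i g ≤ g := by
      have := Nat.floor_le (div_nonneg hlg hlog0.le)
      rw [le_div_iff₀ hlog0] at this
      rw [← Real.log_le_log_iff (by positivity) (by linarith), Real.log_pow]
      exact this
    have h2 : (g : ℝ) ≤ (1 + δ) ^ (i g + 1) := by
      have := (Nat.lt_floor_add_one (Real.log g / Real.log (1 + δ))).le
      rw [div_le_iff₀ hlog0] at this
      rw [← Real.log_le_log_iff (by linarith) (by positivity), Real.log_pow]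
      push_cast
      exact this
    have hp : 0 < (1 + δ) ^ i g := by positivity
    constructor
    · exact (div_le_div_of_nonneg_left hΛ0.le hp h1).trans (Nat.le_ceil _)
    · refine (Nat.ceil_lt_add_one (by positivity)).le.trans ?_
      have h3 : Λ / (1 + δ) ^ i g ≤ (1 + δ) * (Λ / g) := by
        rw [div_le_iff₀ hp, mul_div_assoc', div_mul_eq_mul_div, le_div_iff₀ (by linarith)]
        rw [pow_succ] at h2
        nlinarith
      have h4 : 1 ≤ δ * (Λ / g) := by
        rw [mul_div_assoc', le_div_iff₀ (by linarith), hΛ, mul_div_cancel₀ _ hδ.ne']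
        linarith
      linarith
  · have hsub : (Finset.Icc 1 M).image (fun g => ⌈Λ / (1 + δ) ^ i g⌉₊) ⊆
        (Finset.range (i M + 1)).image (fun j => ⌈Λ / (1 + δ) ^ j⌉₊) := by
      intro x hx
      obtain ⟨g, hg, rfl⟩ := Finset.mem_image.1 hx
      rw [Finset.mem_Icc] at hg
      refine Finset.mem_image.2 ⟨i g, ?_, rfl⟩
      rw [Finset.mem_range, Nat.lt_succ_iff]
      have hg0 : (0 : ℝ) < g := by exact_mod_cast hg.1
      exact Nat.floor_le_floor (div_le_div_of_nonneg_right
        (Real.log_le_log hg0 (by exact_mod_cast hg.2)) hlog0.le)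
    have h1 : ((Finset.Icc 1 M).image (fun g => ⌈Λ / (1 + δ) ^ i g⌉₊)).card ≤ i M + 1 :=
      (Finset.card_le_card hsub).trans (Finset.card_image_le.trans (by simp))
    have hlM : 0 ≤ Real.log M := Real.log_nonneg hM0
    have h2 : (i M : ℝ) ≤ 2 * Real.log M / δ := by
      refine (Nat.floor_le (div_nonneg hlM hlog0.le)).trans ?_
      rw [div_le_div_iff₀ hlog0 hδ]
      nlinarith
    have h3 : (((Finset.Icc 1 M).image (fun g => ⌈Λ / (1 + δ) ^ i g⌉₊)).card : ℝ) ≤ i M + 1 := by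
      exact_mod_cast h1
    linarith

variable {α : Type*} [DecidableEq α]

/-- The potential of the available letters `Q` when `s` is still to be crossed. -/
noncomputable def potential (K : ℕ) (Q : Finset α) (s : List α) : ℝ :=
  ∑ a ∈ Q, 1 / ((s.count a : ℝ) + K)

theorem potential_le_cons_add {K : ℕ} (hK : 1 ≤ K) (Q : Finset α) (x : α) (s : List α) :
    potential K Q s ≤ potential K Q (x :: s) + 1 / K := by
  have hK0 : (0 : ℝ) < K := by exact_mod_cast hK
  have h : ∀ a ∈ Q, 1 / ((s.count a : ℝ) + K) ≤
      1 / (((x :: s).count a : ℝ) + K) + if a = x then (1 / K : ℝ) else 0 := by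
    intro a _
    rw [List.count_cons]
    by_cases hax : a = x
    · have h1 : 1 / ((s.count a : ℝ) + K) ≤ 1 / K :=
        div_le_div_of_nonneg_left (by norm_num) hK0 (by linarith [(s.count a).cast_nonneg (α := ℝ)])
      rw [if_pos hax]
      exact h1.trans (le_add_of_nonneg_left (by positivity))
    · have : ¬ x = a := fun e => hax e.symm
      simp [hax, this]
  refine (Finset.sum_le_sum h).trans ?_
  rw [Finset.sum_add_distrib, potential]
  gcongr
  rw [Finset.sum_ite_eq']
  split_ifs
  · exact le_rfl
  · positivity

theorem exists_split_potential {K : ℕ} (hK : 1 ≤ K) (Q : Finset α) {A : ℝ} (s : List α)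
    (hs : potential K Q s < A) (hA : A ≤ potential K Q []) :
    ∃ s₁ s₂, s = s₁ ++ s₂ ∧ A ≤ potential K Q s₂ ∧ potential K Q s₂ ≤ A + 1 / K := by
  induction s with
  | nil => exact absurd hA (not_le.2 hs)
  | cons x s ih =>
    by_cases h : potential K Q s < A
    · obtain ⟨s₁, s₂, rfl, h1, h2⟩ := ih h
      exact ⟨x :: s₁, s₂, rfl, h1, h2⟩
    · exact ⟨[x], s, rfl, not_lt.1 h, (potential_le_cons_add hK Q x s).trans (by linarith)⟩

/-- Crossing `s₁` by a word of distinct letters of `Q` costs about as much as the potential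
increases, relative to its value. -/
theorem exists_word_of_potential [Fintype α] {δ ω : ℝ} (hδ : 0 < δ) (hδ1 : δ < 1) (hω : 0 < ω)
    (hω1 : ω ≤ 1) {K M : ℕ} (hK : 1 ≤ K) (Q : Finset α) (s₁ s₂ : List α)
    (hM : s₂.length + K ≤ M) (hN : (2 * Real.log M / δ + 1) * ω ≤ δ)
    (hΨ : 1 ≤ potential K Q (s₁ ++ s₂)) {B : ℝ}
    (hB : (1 + 2 * δ) * ((potential K Q s₂ - potential K Q (s₁ ++ s₂)) /
      potential K Q (s₁ ++ s₂) + 1 / K) ≤ (1 - δ) * B) (hBω : B < ω) :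
    ∃ w : List α, w.Nodup ∧ (∀ b ∈ w, b ∈ Q) ∧ ¬ w.Sublist s₁ ∧
      (w.map fun b => 1 / ((s₂.count b : ℝ) + K)).sum ≤ B := by
  obtain ⟨r, Λ, hΛ, hr, hcard⟩ := exists_cost_grid hδ hδ1.le M (by omega)
  set Ψ := potential K Q (s₁ ++ s₂) with hΨdef
  have hΨ0 : 0 < Ψ := by linarith
  have hK0 : (0 : ℝ) < K := by exact_mod_cast hK
  set G : α → ℝ := fun b => ((s₁ ++ s₂).count b : ℝ) + K with hG
  set g : α → ℝ := fun b => (s₂.count b : ℝ) + K with hg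
  have hGg : ∀ b, G b = s₁.count b + g b := by
    intro b; simp only [hG, hg, List.count_append, Nat.cast_add]; ring
  have hgK : ∀ b, (K : ℝ) ≤ g b := fun b => by
    simp only [hg]; linarith [(s₂.count b).cast_nonneg (α := ℝ)]
  have hg0 : ∀ b, 0 < g b := fun b => hK0.trans_le (hgK b)
  have hgG : ∀ b, g b ≤ G b := fun b => by
    rw [hGg]; linarith [(s₁.count b).cast_nonneg (α := ℝ)]
  have hG0 : ∀ b, 0 < G b := fun b => (hg0 b).trans_le (hgG b)
  set c : α → ℕ := fun b => r (s₂.count b + K) with hc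
  set y : α → ℝ := fun b => if b ∈ Q then 1 / G b / Ψ else 0 with hy
  have hcr : ∀ b, Λ / g b ≤ c b ∧ (c b : ℝ) ≤ (1 + 2 * δ) * (Λ / g b) := by
    intro b
    have := hr (s₂.count b + K) (by omega)
      ((Nat.add_le_add_right List.count_le_length K).trans hM)
    simpa only [hg, hc, Nat.cast_add] using this
  have hy0 : ∀ b, 0 ≤ y b := by
    intro b
    simp only [hy]
    split_ifs
    · exact div_nonneg (div_nonneg zero_le_one (hG0 b).le) hΨ0.le
    · exact le_rfl
  have hysum : ∀ F : α → ℝ, ∑ b, y b * F b = ∑ b ∈ Q, 1 / G b / Ψ * F b := by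
    intro F
    simp only [hy, ite_mul, zero_mul, Finset.sum_ite_mem, Finset.univ_inter]
  have hy1 : ∑ b, y b = 1 := by
    have := hysum fun _ => 1
    simp only [mul_one] at this
    rw [this, ← Finset.sum_div]
    exact div_self hΨ0.ne'
  have hbud := budget_le (c := c) hy0 hy1 hω.le hω1 s₁
  set h := budget y c ω s₁ with hh
  have hcard' : ((Finset.univ.image c).card : ℝ) * ω ≤ δ := by
    refine le_trans (mul_le_mul_of_nonneg_right ?_ hω.le) hN
    refine le_trans ?_ hcard
    have hsub : Finset.univ.image c ⊆ (Finset.Icc 1 M).image r := by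
      intro x hx
      obtain ⟨b, -, rfl⟩ := Finset.mem_image.1 hx
      refine Finset.mem_image.2 ⟨s₂.count b + K, Finset.mem_Icc.2 ⟨by omega, ?_⟩, rfl⟩
      exact (Nat.add_le_add_right List.count_le_length K).trans hM
    exact_mod_cast Finset.card_le_card hsub
  have hsum : ∑ b, y b * (c b * (s₁.count b + 1)) ≤
      (1 + 2 * δ) * Λ * ((potential K Q s₂ - Ψ) / Ψ + 1 / K) := by
    rw [hysum]
    -- The weight is `1 / G`, the price about `Λ / g`, and the letter occurs `G - g` times in `s₁`;
    -- their product telescopes to `1 / g - 1 / G`.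
    have hterm : ∀ b ∈ Q, 1 / G b / Ψ * (c b * (s₁.count b + 1)) ≤
        (1 + 2 * δ) * Λ / Ψ * ((1 / g b - 1 / G b) + 1 / G b * (1 / K)) := by
      intro b _
      have h1 : 1 / g b - 1 / G b = s₁.count b * (1 / (g b * G b)) := by
        have := hGg b
        field_simp [(hg0 b).ne', (hG0 b).ne']
        linarith
      have h2 : 1 / (g b * G b) ≤ 1 / G b * (1 / K) := by
        rw [one_div_mul_one_div, mul_comm (G b)]
        exact one_div_le_one_div_of_le (mul_pos hK0 (hG0 b))
          (mul_le_mul_of_nonneg_right (hgK b) (hG0 b).le)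
      calc 1 / G b / Ψ * (c b * (s₁.count b + 1))
          ≤ 1 / G b / Ψ * ((1 + 2 * δ) * (Λ / g b) * (s₁.count b + 1)) := by
            refine mul_le_mul_of_nonneg_left ?_
              (div_nonneg (div_nonneg zero_le_one (hG0 b).le) hΨ0.le)
            exact mul_le_mul_of_nonneg_right (hcr b).2 (by positivity)
        _ = (1 + 2 * δ) * Λ / Ψ * (s₁.count b * (1 / (g b * G b)) + 1 / (g b * G b)) := by
            field_simp [(hg0 b).ne', (hG0 b).ne']
        _ ≤ _ := by
            rw [h1]
            refine mul_le_mul_of_nonneg_left (by linarith) (by positivity)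
    refine (Finset.sum_le_sum hterm).trans (le_of_eq ?_)
    rw [← Finset.mul_sum, Finset.sum_add_distrib, Finset.sum_sub_distrib, ← Finset.sum_mul]
    change (1 + 2 * δ) * Λ / Ψ * (potential K Q s₂ - Ψ + Ψ * (1 / K)) = _
    field_simp
  have hfin : (h : ℝ) / Λ ≤ B := by
    have h1 : (1 - δ) * (h : ℝ) ≤ (1 - δ) * B * Λ := by
      have h2 : ((Finset.univ.image c).card : ℝ) * ω * h ≤ δ * h :=
        mul_le_mul_of_nonneg_right hcard' (Nat.cast_nonneg _)
      have h3 := mul_le_mul_of_nonneg_right hB hΛ.le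
      linarith
    rw [div_le_iff₀ hΛ]
    have : 0 < 1 - δ := by linarith
    refine le_of_mul_le_mul_left ?_ this
    linarith
  -- Weight is at most price over `Λ` because `Ψ ≥ 1` and `g ≤ G`. The forbidden set `Qᶜ` has weight
  -- zero, so only `B < ω` is needed.
  obtain ⟨w, hw1, hw2, hw3, hw4⟩ := exists_word_of_budget (c := c) hy0 hy1 hω1
    (κ := 1 / Λ) (by positivity) (by
      intro b
      have h1 : 1 / g b ≤ 1 / Λ * c b := by
        have := (hcr b).1
        rw [div_mul_eq_mul_div, one_mul, le_div_iff₀ hΛ]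
        rwa [div_mul_eq_mul_div, one_mul]
      refine le_trans ?_ h1
      have h2 : 1 / G b ≤ 1 / g b := one_div_le_one_div_of_le (hg0 b) (hgG b)
      simp only [hy]
      split_ifs
      · refine le_trans (div_le_self (div_nonneg zero_le_one (hG0 b).le) hΨ) h2
      · exact div_nonneg zero_le_one (hg0 b).le) s₁ Qᶜ (by
      have : ∑ b ∈ Qᶜ, y b = 0 := Finset.sum_eq_zero fun b hb => by
        simp only [hy, if_neg (Finset.mem_compl.1 hb)]
      rw [this, zero_add, one_div_mul_eq_div]
      exact hfin.trans_lt hBω)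
  refine ⟨w, hw1, fun b hb => by simpa using hw2 b hb, hw3, le_trans ?_ hfin⟩
  have h5 : (w.map fun b => 1 / g b).sum ≤ (w.map fun b => (c b : ℝ) / Λ).sum := by
    refine List.sum_le_sum fun b _ => ?_
    rw [le_div_iff₀ hΛ, div_mul_eq_mul_div, one_mul]
    exact (hcr b).1
  refine h5.trans ?_
  have h6 : (w.map fun b => (c b : ℝ) / Λ).sum = (((w.map c).sum : ℕ) : ℝ) / Λ := by
    clear hw1 hw2 hw3 hw4 h5
    induction w with
    | nil => simp
    | cons b w ih => simp only [List.map_cons, List.sum_cons, ih, Nat.cast_add, add_div]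
  rw [h6]
  exact div_le_div_of_nonneg_right (by exact_mod_cast hw4) hΛ.le

/-- Crossing a piece consumes no more potential than the piece gains, so the lower bound `1 + 10 *
δ` is an invariant of the induction. -/
theorem exists_nodup_not_sublist [Fintype α] {δ ω θ : ℝ} (hδ : 0 < δ) (hδ1 : δ ≤ 1 / 10)
    (hω1 : ω ≤ 1) (hθ : 0 < θ) (hθω : 3 * θ ≤ ω) {K M : ℕ} (hK : 1 ≤ K) (hKθ : 1 / K ≤ δ * θ)
    (hN : (2 * Real.log M / δ + 1) * ω ≤ δ) (s : List α) (hM : s.length + K ≤ M) (Q : Finset α)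
    (hQ : 1 + 10 * δ ≤ potential K Q s) :
    ∃ w : List α, w.Nodup ∧ (∀ b ∈ w, b ∈ Q) ∧ ¬ w.Sublist s := by
  induction hn : s.length using Nat.strong_induction_on generalizing s Q with
  | _ n ih =>
  subst hn
  have hω : 0 < ω := by linarith
  have hΨ0 : 0 < potential K Q s := by linarith
  -- The slack `10 * δ` pays for the rounding of prices, the term `1 / K` and the loss in
  -- `budget_le`. The floor `θ` serves the last piece, where the gain `P` may be too small to absorb
  -- `1 / K`.
  have key : ∀ P Ψ : ℝ, 1 + 10 * δ ≤ Ψ → P ≤ θ + 1 / K →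
      (1 + 2 * δ) * (P / Ψ + 1 / K) ≤ (1 - δ) * (max θ P) ∧ max θ P < ω := by
    intro P Ψ hΨ hP
    have hm : θ ≤ max θ P := le_max_left _ _
    have h1 : P / Ψ ≤ max θ P / (1 + 10 * δ) := by
      refine (div_le_div_of_nonneg_right (le_max_right θ P) (by linarith)).trans ?_
      exact div_le_div_of_nonneg_left (by linarith) (by linarith) hΨ
    have h2 : 1 / (K : ℝ) ≤ δ * max θ P := hKθ.trans (mul_le_mul_of_nonneg_left hm hδ.le)
    constructor
    · have h3 : (1 + 2 * δ) * (1 / (1 + 10 * δ) + δ) ≤ 1 - δ := by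
        rw [div_add' _ _ _ (by positivity), mul_div_assoc', div_le_iff₀ (by positivity)]
        nlinarith [mul_nonneg hδ.le hδ.le, mul_nonneg (mul_nonneg hδ.le hδ.le) hδ.le]
      calc (1 + 2 * δ) * (P / Ψ + 1 / K)
          ≤ (1 + 2 * δ) * (max θ P / (1 + 10 * δ) + δ * max θ P) := by gcongr
        _ = (1 + 2 * δ) * (1 / (1 + 10 * δ) + δ) * max θ P := by ring
        _ ≤ (1 - δ) * max θ P := mul_le_mul_of_nonneg_right h3 (by linarith)
    · have : δ * θ ≤ θ := by nlinarith
      exact max_lt (by linarith) (by linarith)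
  -- If less than `θ` remains to be gained, all of `s` is crossed at once.
  by_cases hend : potential K Q [] < potential K Q s + θ
  · obtain ⟨h1, h2⟩ := key (potential K Q [] - potential K Q s) _ hQ
      (by have : (0 : ℝ) ≤ 1 / K := by positivity
          linarith)
    obtain ⟨w, hw1, hw2, hw3, -⟩ := exists_word_of_potential hδ (by linarith) hω hω1 hK Q s []
      (M := M) (by simp only [List.length_nil]; omega) hN
      (by rw [List.append_nil]; linarith) (by rw [List.append_nil]; exact h1) h2
    exact ⟨w, hw1, hw2, hw3⟩
  · obtain ⟨s₁, s₂, rfl, h1, h2⟩ := exists_split_potential hK Q (A := potential K Q s + θ) s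
      (by linarith) (not_lt.1 hend)
    set P := potential K Q s₂ - potential K Q (s₁ ++ s₂) with hP
    obtain ⟨h3, h4⟩ := key P _ hQ (by linarith)
    rw [max_eq_right (by linarith)] at h3 h4
    rw [List.length_append] at hM
    obtain ⟨w, hw1, hw2, hw3, hw4⟩ := exists_word_of_potential hδ (by linarith) hω hω1 hK Q s₁ s₂
      (M := M) (by omega) hN (by linarith) h3 h4
    have hne : s₁ ≠ [] := by
      rintro rfl
      rw [List.nil_append] at h1
      linarith
    have hwsub : w.toFinset ⊆ Q := fun b hb => hw2 b (List.mem_toFinset.1 hb)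
    have hpot : potential K (Q \ w.toFinset) s₂ + (w.map fun b => 1 / ((s₂.count b : ℝ) + K)).sum =
        potential K Q s₂ := by
      rw [← List.sum_toFinset _ hw1, potential, potential, Finset.sum_sdiff hwsub]
    obtain ⟨w', hw1', hw2', hw3'⟩ := ih s₂.length
      (by rw [List.length_append]; have := List.length_pos_iff.2 hne; omega) s₂ (by omega)
      (Q \ w.toFinset) (by linarith) rfl
    refine ⟨w ++ w', ?_, ?_, not_append_sublist_append hw3 hw3'⟩
    · refine List.nodup_append'.2 ⟨hw1, hw1', fun b hb hb' => ?_⟩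
      exact (Finset.mem_sdiff.1 (hw2' b hb')).2 (List.mem_toFinset.2 hb)
    · intro b hb
      rcases List.mem_append.1 hb with hb | hb
      · exact hw2 b hb
      · exact (Finset.mem_sdiff.1 (hw2' b hb)).1

/-- A word of distinct letters is an initial segment of a permutation. -/
theorem exists_perm_ofFn {n : ℕ} {w : List (Fin n)} (hw : w.Nodup) :
    ∃ σ : Equiv.Perm (Fin n), w.Sublist (List.ofFn σ) := by
  set v := w ++ (Finset.univ.filter fun b => b ∉ w).toList with hv
  have hnd : v.Nodup := by
    refine List.nodup_append'.2 ⟨hw, Finset.nodup_toList _, fun b hb hb' => ?_⟩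
    rw [Finset.mem_toList, Finset.mem_filter] at hb'
    exact hb'.2 hb
  have hmem : ∀ b, b ∈ v := by
    intro b
    by_cases hb : b ∈ w
    · exact List.mem_append_left _ hb
    · exact List.mem_append_right _ (by simpa using hb)
  have hlen : v.length = n := by
    rw [← List.toFinset_card_of_nodup hnd, show v.toFinset = Finset.univ by ext; simp [hmem],
      Finset.card_univ, Fintype.card_fin]
  set e := hnd.getEquivOfForallMemList v hmem with he
  refine ⟨(finCongr hlen.symm).trans e, ?_⟩
  have : List.ofFn ((finCongr hlen.symm).trans e) = v := by
    refine List.ext_getElem (by simp [hlen]) fun i h1 h2 => ?_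
    rw [List.getElem_ofFn]
    rfl
  rw [this]
  exact List.sublist_append_left _ _

theorem card_sq_lt_of_forall_sublist {n : ℕ} (s : List (Fin n))
    (hs : ∀ σ : Equiv.Perm (Fin n), (List.ofFn σ).Sublist s) {δ ω θ : ℝ} (hδ : 0 < δ)
    (hδ1 : δ ≤ 1 / 10) (hω1 : ω ≤ 1) (hθ : 0 < θ) (hθω : 3 * θ ≤ ω) {K : ℕ} (hK : 1 ≤ K)
    (hKθ : 1 / K ≤ δ * θ) (hN : (2 * Real.log (s.length + K : ℕ) / δ + 1) * ω ≤ δ) :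
    (n : ℝ) ^ 2 ≤ (1 + 10 * δ) * (s.length + n * K) := by
  by_contra! hlt
  have hK0 : (0 : ℝ) < K := by exact_mod_cast hK
  have hn : 0 < n := by
    rcases Nat.eq_zero_or_pos n with rfl | h
    · have : (0 : ℝ) ≤ (1 + 10 * δ) * (s.length + (0 : ℕ) * K) := by positivity
      norm_num at hlt this
      linarith
    · exact h
  have hn0 : (0 : ℝ) < n := by exact_mod_cast hn
  have hcount : ∑ a : Fin n, ((s.count a : ℝ) + K) = s.length + n * K := by
    rw [Finset.sum_add_distrib]
    congr 1
    · have := Multiset.sum_count_eq_card (s := Finset.univ) (m := (s : Multiset (Fin n)))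
        (fun a _ => Finset.mem_univ a)
      simp only [Multiset.coe_count, Multiset.coe_card] at this
      exact_mod_cast this
    · simp
  have hpot : 1 + 10 * δ ≤ potential K Finset.univ s := by
    have h := Finset.sq_sum_div_le_sum_sq_div Finset.univ (fun _ : Fin n => (1 : ℝ))
      (g := fun a => (s.count a : ℝ) + K) (fun a _ => by positivity)
    simp only [hcount, one_pow, Finset.sum_const, Finset.card_univ, Fintype.card_fin, nsmul_eq_mul,
      mul_one] at h
    refine le_trans ?_ h
    rw [le_div_iff₀ (by positivity)]
    exact hlt.le
  obtain ⟨w, hw1, -, hw3⟩ := exists_nodup_not_sublist hδ hδ1 hω1 hθ hθω hK hKθ hN s le_rfl _ hpot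
  obtain ⟨σ, hσ⟩ := exists_perm_ofFn hw1
  exact hw3 (hσ.trans (hs σ))

end Supersequence

/-- About `log n / δ` prices force `ω` to be of order `δ ^ 2 / log n`. With `K` about `δ * n`, the
requirement `1 / K ≤ δ * θ` becomes the hypothesis on `δ ^ 4 * n`, the source of the exponent `7 / 4
= 2 - 1 / 4`. -/
theorem card_sq_le_length_add {n : ℕ} (s : List (Fin n))
    (hs : ∀ σ : Equiv.Perm (Fin n), (List.ofFn σ).Sublist s) {δ : ℝ} (hδ : 0 < δ)
    (hδ1 : δ ≤ 1 / 10) (hn : 3 ≤ n) (hδn : 21 * Real.log n ≤ δ ^ 4 * n) :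
    (n : ℝ) ^ 2 ≤ s.length + 14 * (δ * n ^ 2) := by
  have hn3 : (3 : ℝ) ≤ n := by exact_mod_cast hn
  have hlog : 1 ≤ Real.log n := by
    rw [Real.le_log_iff_exp_le (by linarith)]
    exact Real.exp_one_lt_d9.le.trans (by linarith)
  rcases le_or_gt ((n : ℝ) ^ 2) s.length with hL | hL
  · have : 0 ≤ δ * (n : ℝ) ^ 2 := by positivity
    linarith
  set K := ⌈δ * n⌉₊ with hK
  have hKle : δ * n ≤ K := Nat.le_ceil _
  have hKlt : (K : ℝ) < δ * n + 1 := Nat.ceil_lt_add_one (by positivity)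
  have hK1 : 1 ≤ K := Nat.one_le_iff_ne_zero.2 (by
    rw [hK, Ne, Nat.ceil_eq_zero, not_le]; positivity)
  have hδn1 : 1 ≤ δ * n := by
    have h1 : δ ^ 4 ≤ δ := by
      simpa using pow_le_pow_of_le_one hδ.le (by linarith) (show 1 ≤ 4 by norm_num)
    have := mul_le_mul_of_nonneg_right h1 (show (0 : ℝ) ≤ n by linarith)
    linarith
  have hM : Real.log (s.length + K : ℕ) ≤ 3 * Real.log n := by
    have h3 : Real.log ((n : ℝ) ^ 3) = 3 * Real.log n := by rw [Real.log_pow]; norm_num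
    rw [← h3]
    refine Real.log_le_log (by push_cast; positivity) ?_
    push_cast
    nlinarith
  have hkey := card_sq_lt_of_forall_sublist s hs (ω := δ ^ 2 / (7 * Real.log n))
    (θ := δ ^ 2 / (21 * Real.log n)) hδ hδ1 (by
      rw [div_le_one (by positivity)]; nlinarith) (by positivity) (by
      apply le_of_eq; field_simp; norm_num) hK1 (by
      calc 1 / (K : ℝ) ≤ 1 / (δ * n) := one_div_le_one_div_of_le (by positivity) hKle
        _ ≤ δ * (δ ^ 2 / (21 * Real.log n)) := by
          rw [mul_div_assoc', div_le_div_iff₀ (by positivity) (by positivity)]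
          linarith) (by
      have h1 : 2 * Real.log (s.length + K : ℕ) / δ + 1 ≤ 7 * Real.log n / δ := by
        rw [div_add_one hδ.ne']
        exact div_le_div_of_nonneg_right (by linarith) hδ.le
      refine (mul_le_mul_of_nonneg_right h1 (by positivity)).trans (le_of_eq ?_)
      field_simp)
  have h1 : (n : ℝ) * K ≤ 2 * (δ * n ^ 2) := by nlinarith
  have h2 : 10 * δ * s.length ≤ 10 * (δ * n ^ 2) := by nlinarith
  have h3 : 10 * δ * (n * K) ≤ n * K := by
    have : 0 ≤ (n : ℝ) * K := by positivity
    nlinarith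
  linarith

/-- A sequence containing all permutations of `n` letters as subsequences has length at least
`n ^ 2 - o(n ^ (7 / 4 + ε))`. -/
theorem exists_length_lower_bound (ε : ℝ) (hε : 0 < ε) :
    ∃ f : ℕ → ℝ, f =o[atTop] (fun n : ℕ => (n : ℝ) ^ (7 / 4 + ε : ℝ)) ∧
      ∀ (n : ℕ) (s : List (Fin n)),
        (∀ σ : Equiv.Perm (Fin n), (List.ofFn σ).Sublist s) →
          (n : ℝ) ^ 2 - f n ≤ (s.length : ℝ) := by
  set η : ℝ := min ε (1 / 4) / 2 with hη
  have hη0 : 0 < η := by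
    have : 0 < min ε (1 / 4) := lt_min hε (by norm_num)
    rw [hη]; linarith
  have hηε : η < ε := by
    have := min_le_left ε (1 / 4); rw [hη]; linarith
  have hη4 : η < 1 / 4 := by
    have := min_le_right ε (1 / 4); rw [hη]; linarith
  have hcast := tendsto_natCast_atTop_atTop (R := ℝ)
  have hev1 : ∀ᶠ n : ℕ in atTop, (n : ℝ) ^ (-(1 / 4 - η)) ≤ 1 / 10 := by
    have := (tendsto_rpow_neg_atTop (show 0 < 1 / 4 - η by linarith)).comp hcast
    exact (this.eventually (ge_mem_nhds (show (0 : ℝ) < 1 / 10 by norm_num)))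
  have hev2 : ∀ᶠ n : ℕ in atTop, 21 * Real.log n ≤ (n : ℝ) ^ (4 * η) := by
    have := ((isLittleO_log_rpow_atTop (show 0 < 4 * η by linarith)).comp_tendsto hcast).def
      (show (0 : ℝ) < 1 / 21 by norm_num)
    filter_upwards [this] with n hn
    have h1 := le_trans (le_abs_self _) hn
    rw [Real.norm_of_nonneg (by simp only [Function.comp]; positivity)] at h1
    simp only [Function.comp] at h1
    linarith
  obtain ⟨n₀, hn₀⟩ := eventually_atTop.1 (hev1.and (hev2.and (eventually_ge_atTop 3)))
  -- The constant `n₀ ^ 2` makes the bound trivial for `n < n₀`.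
  refine ⟨fun n => 14 * (n : ℝ) ^ (7 / 4 + η) + (n₀ : ℝ) ^ 2, ?_, ?_⟩
  · refine IsLittleO.add ?_ ?_
    · refine IsLittleO.const_mul_left ?_ 14
      refine (isLittleO_iff_tendsto' ?_).2 ?_
      · filter_upwards [eventually_gt_atTop 0] with n hn h0
        exact absurd h0 (by positivity)
      · have := (tendsto_rpow_neg_atTop (show 0 < ε - η by linarith)).comp hcast
        refine this.congr' ?_
        filter_upwards [eventually_gt_atTop 0] with n hn
        have hn0 : (0 : ℝ) < n := by exact_mod_cast hn
        rw [Function.comp, ← Real.rpow_sub hn0]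
        congr 1
        ring
    · refine (isLittleO_const_left.2 (Or.inr ?_))
      refine tendsto_norm_atTop_atTop.comp ((tendsto_rpow_atTop (by linarith)).comp hcast)
  · intro n s hs
    have hpos : 0 ≤ (n : ℝ) ^ (7 / 4 + η) := by positivity
    rcases lt_or_ge n n₀ with h | h
    · have h1 : (n : ℝ) ^ 2 ≤ (n₀ : ℝ) ^ 2 :=
        pow_le_pow_left₀ (Nat.cast_nonneg _) (by exact_mod_cast h.le) 2
      have : (0 : ℝ) ≤ s.length := Nat.cast_nonneg _
      linarith
    · obtain ⟨h1, h2, h3⟩ := hn₀ n h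
      have hn0 : (0 : ℝ) < n := by exact_mod_cast (by omega : 0 < n)
      have hpow4 : ((n : ℝ) ^ (-(1 / 4 - η))) ^ 4 * n = (n : ℝ) ^ (4 * η) := by
        rw [← Real.rpow_natCast, ← Real.rpow_mul hn0.le, ← Real.rpow_add_one hn0.ne']
        congr 1
        push_cast
        ring
      have hpow2 : (n : ℝ) ^ (-(1 / 4 - η)) * (n : ℝ) ^ 2 = (n : ℝ) ^ (7 / 4 + η) := by
        rw [← Real.rpow_natCast, ← Real.rpow_add hn0]
        congr 1
        push_cast
        ring
      have := card_sq_le_length_add s hs (δ := (n : ℝ) ^ (-(1 / 4 - η))) (by positivity) h1 h3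
        (by rw [hpow4]; exact h2)
      rw [hpow2] at this
      have : (0 : ℝ) ≤ (n₀ : ℝ) ^ 2 := by positivity
      linarith

/-! ### Reflections that detect reduced words -/

section Reflections

/-- A multiple of a reflection for real `s`; a nilpotent matrix for `s = i`. -/
noncomputable def reflection (t : ℝ) (s : ℂ) : Matrix (Fin 2) (Fin 2) ℂ :=
  !![-(t : ℂ), (1 - (t : ℂ) ^ 2) / 2 - Complex.I * s * (1 + (t : ℂ) ^ 2) / 2;
    (1 - (t : ℂ) ^ 2) / 2 + Complex.I * s * (1 + (t : ℂ) ^ 2) / 2, (t : ℂ)]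

/-- The square of `reflection t s` is this scalar. -/
noncomputable def reflectionSq (t : ℝ) (s : ℂ) : ℂ := (1 + (t : ℂ) ^ 2) ^ 2 * (1 + s ^ 2) / 4

/-- The vector obtained from `(1, 0)` by the reflections with parameters `l`, the last one first. -/
noncomputable def orbitVec (s : ℂ) : List ℝ → Fin 2 → ℂ
  | [] => ![1, 0]
  | t :: l => reflection t s *ᵥ orbitVec s l

theorem reflection_mul_self (t : ℝ) (s : ℂ) :
    reflection t s * reflection t s = reflectionSq t s • (1 : Matrix (Fin 2) (Fin 2) ℂ) := by
  have hI := Complex.I_sq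
  ext i j
  fin_cases i <;> fin_cases j <;>
    simp [reflection, reflectionSq, Matrix.mul_apply, Fin.sum_univ_two] <;> ring_nf <;>
    simp only [hI] <;> ring

theorem reflectionSq_ofReal (t s : ℝ) :
    reflectionSq t s = (((1 + t ^ 2) ^ 2 * (1 + s ^ 2) / 4 : ℝ) : ℂ) := by
  simp [reflectionSq]

theorem reflectionSq_ne_zero (t s : ℝ) : reflectionSq t s ≠ 0 := by
  rw [reflectionSq_ofReal, Complex.ofReal_ne_zero]
  positivity

/-- The determinant of two vectors. -/
def cross (u v : Fin 2 → ℂ) : ℂ := u 0 * v 1 - u 1 * v 0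

theorem cross_smul (a b : ℂ) (u v : Fin 2 → ℂ) : cross (a • u) (b • v) = a * b * cross u v := by
  simp only [cross, Pi.smul_apply, smul_eq_mul]
  ring

theorem cross_reflection (t : ℝ) (s : ℂ) (u v : Fin 2 → ℂ) :
    cross (reflection t s *ᵥ u) (reflection t s *ᵥ v) = -reflectionSq t s * cross u v := by
  have hI := Complex.I_sq
  simp only [cross, reflection, reflectionSq, Matrix.mulVec, dotProduct, Fin.sum_univ_two,
    Matrix.of_apply, Matrix.cons_val_zero, Matrix.cons_val_one, Matrix.cons_val']
  ring_nf
  simp only [hI]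
  ring

theorem exists_polynomial_orbitVec (l : List ℝ) :
    ∃ P : Fin 2 → Polynomial ℂ, ∀ s i, orbitVec s l i = (P i).eval s := by
  induction l with
  | nil => exact ⟨![1, 0], fun s i => by fin_cases i <;> simp [orbitVec]⟩
  | cons t l ih =>
    obtain ⟨P, hP⟩ := ih
    refine ⟨![-Polynomial.C (t : ℂ) * P 0 + (Polynomial.C ((1 - (t : ℂ) ^ 2) / 2) -
        Polynomial.X * Polynomial.C (Complex.I * (1 + (t : ℂ) ^ 2) / 2)) * P 1,
      (Polynomial.C ((1 - (t : ℂ) ^ 2) / 2) +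
        Polynomial.X * Polynomial.C (Complex.I * (1 + (t : ℂ) ^ 2) / 2)) * P 0 +
        Polynomial.C (t : ℂ) * P 1], fun s i => ?_⟩
    fin_cases i <;>
      simp only [orbitVec, reflection, Matrix.mulVec, dotProduct, Fin.sum_univ_two, hP,
        Matrix.of_apply, Matrix.cons_val_zero, Matrix.cons_val_one, Matrix.cons_val',
        Fin.zero_eta, Fin.mk_one, Polynomial.eval_add, Polynomial.eval_mul, Polynomial.eval_sub,
        Polynomial.eval_neg, Polynomial.eval_C, Polynomial.eval_X] <;> ring

/-- The determinant is a polynomial in `s`, so vanishing on the real line it vanishes at `i`. -/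
theorem cross_orbitVec_I_eq_zero {l m : List ℝ}
    (h : ∀ s : ℝ, cross (orbitVec s l) (orbitVec s m) = 0) :
    cross (orbitVec Complex.I l) (orbitVec Complex.I m) = 0 := by
  obtain ⟨P, hP⟩ := exists_polynomial_orbitVec l
  obtain ⟨R, hR⟩ := exists_polynomial_orbitVec m
  have key : ∀ s, cross (orbitVec s l) (orbitVec s m) = (P 0 * R 1 - P 1 * R 0).eval s := by
    intro s
    simp only [cross, hP, hR, Polynomial.eval_sub, Polynomial.eval_mul]
  have hzero : P 0 * R 1 - P 1 * R 0 = 0 := by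
    refine Polynomial.eq_zero_of_infinite_isRoot _
      ((Set.infinite_range_of_injective Complex.ofReal_injective).mono ?_)
    rintro _ ⟨s, rfl⟩
    change (P 0 * R 1 - P 1 * R 0).eval (s : ℂ) = 0
    rw [← key, h]
  rw [key, hzero, Polynomial.eval_zero]

theorem reflection_I_mulVec (t : ℝ) (v : Fin 2 → ℂ) :
    reflection t Complex.I *ᵥ v = (v 1 - t * v 0) • ![1, (t : ℂ)] := by
  have hI := Complex.I_mul_I
  ext i
  fin_cases i <;>
    simp [reflection, Matrix.mulVec, dotProduct, Fin.sum_univ_two] <;> ring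

/-- At `s = i` the matrix with parameter `t` has both image and kernel spanned by `(1, t)`, so only
equal neighbours annihilate. The start vector `(1, 0)` acts as parameter `0`, whence the default of
`headD` and the positivity hypothesis. -/
theorem exists_orbitVec_I {l : List ℝ} (hl : l.IsChain (· ≠ ·)) (hpos : ∀ t ∈ l, 0 < t) :
    ∃ a : ℂ, a ≠ 0 ∧ orbitVec Complex.I l = a • ![1, ((l.headD 0 : ℝ) : ℂ)] := by
  induction l with
  | nil => exact ⟨1, one_ne_zero, by simp [orbitVec]⟩
  | cons t l ih =>
    obtain ⟨a, ha, h⟩ := ih hl.tail fun x hx => hpos x (List.mem_cons_of_mem _ hx)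
    refine ⟨a * ((l.headD 0 : ℝ) - t), mul_ne_zero ha ?_, ?_⟩
    · rw [sub_ne_zero, Ne, Complex.ofReal_inj]
      cases l with
      | nil => exact (hpos t List.mem_cons_self).ne
      | cons x l => exact (List.isChain_cons_cons.1 hl).1.symm
    · rw [orbitVec, reflection_I_mulVec, h]
      congr 1
      simp
      ring

/-- The value at `s = i` forces equal heads. For real `s` the common head is invertible and can be
stripped off. -/
theorem eq_of_cross_orbitVec {l m : List ℝ} (hl : l.IsChain (· ≠ ·)) (hlpos : ∀ t ∈ l, 0 < t)
    (hm : m.IsChain (· ≠ ·)) (hmpos : ∀ t ∈ m, 0 < t)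
    (h : ∀ s : ℝ, cross (orbitVec s l) (orbitVec s m) = 0) : l = m := by
  induction l generalizing m with
  | nil =>
    obtain ⟨a, ha, h1⟩ := exists_orbitVec_I hl hlpos
    obtain ⟨b, hb, h2⟩ := exists_orbitVec_I hm hmpos
    have h3 := cross_orbitVec_I_eq_zero h
    rw [h1, h2, cross_smul] at h3
    cases m with
    | nil => rfl
    | cons x m =>
      have := hmpos x List.mem_cons_self
      simp [cross, ha, hb, this.ne'] at h3
  | cons t l ih =>
    obtain ⟨a, ha, h1⟩ := exists_orbitVec_I hl hlpos
    obtain ⟨b, hb, h2⟩ := exists_orbitVec_I hm hmpos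
    have h3 := cross_orbitVec_I_eq_zero h
    rw [h1, h2, cross_smul] at h3
    have h4 : m.headD 0 = t := by
      simp only [cross, mul_eq_zero, ha, hb, false_or, List.headD_cons] at h3
      simpa [sub_eq_zero] using h3
    cases m with
    | nil => exact absurd h4 (hlpos t List.mem_cons_self).ne
    | cons x m =>
      obtain rfl : x = t := h4
      congr 1
      refine ih hl.tail (fun y hy => hlpos y (List.mem_cons_of_mem _ hy)) hm.tail
        (fun y hy => hmpos y (List.mem_cons_of_mem _ hy)) fun s => ?_
      have h5 := h s
      rw [orbitVec, orbitVec, cross_reflection] at h5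
      exact (mul_eq_zero.1 h5).resolve_left (neg_ne_zero.2 (reflectionSq_ne_zero _ _))

/-- Cancelling equal neighbours. -/
theorem exists_reduced_sublist (l : List ℝ) :
    ∃ l' : List ℝ, l'.Sublist l ∧ l'.IsChain (· ≠ ·) ∧
      ∀ s : ℝ, ∃ a : ℂ, a ≠ 0 ∧ orbitVec s l = a • orbitVec s l' := by
  induction l with
  | nil => exact ⟨[], List.Sublist.refl _, List.isChain_nil, fun s => ⟨1, one_ne_zero, by simp⟩⟩
  | cons t l ih =>
    obtain ⟨l', h1, h2, h3⟩ := ih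
    by_cases hc : (t :: l').IsChain (· ≠ ·)
    · refine ⟨t :: l', h1.cons_cons t, hc, fun s => ?_⟩
      obtain ⟨a, ha, h⟩ := h3 s
      exact ⟨a, ha, by rw [orbitVec, h, Matrix.mulVec_smul, orbitVec]⟩
    · cases l' with
      | nil => exact absurd (List.isChain_singleton t) hc
      | cons x l' =>
        have hx : t = x := by
          by_contra hne
          exact hc (List.isChain_cons_cons.2 ⟨hne, h2⟩)
        subst hx
        -- Two equal neighbours multiply to a nonzero scalar and are both dropped.
        refine ⟨l', ((List.sublist_cons_self t l').trans h1).trans (List.sublist_cons_self t l),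
          h2.tail, fun s => ?_⟩
        obtain ⟨a, ha, h⟩ := h3 s
        refine ⟨a * reflectionSq t s, mul_ne_zero ha (reflectionSq_ne_zero _ _), ?_⟩
        rw [orbitVec, h, orbitVec, Matrix.mulVec_smul, Matrix.mulVec_mulVec, reflection_mul_self,
          Matrix.smul_mulVec, Matrix.one_mulVec, smul_smul]

theorem sublist_of_cross_orbitVec {l m : List ℝ} (hlpos : ∀ t ∈ l, 0 < t)
    (hm : m.IsChain (· ≠ ·)) (hmpos : ∀ t ∈ m, 0 < t)
    (h : ∀ s : ℝ, cross (orbitVec s l) (orbitVec s m) = 0) : m.Sublist l := by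
  obtain ⟨l', h1, h2, h3⟩ := exists_reduced_sublist l
  have : l' = m := by
    refine eq_of_cross_orbitVec h2 (fun t ht => hlpos t (h1.subset ht)) hm hmpos fun s => ?_
    obtain ⟨a, ha, h4⟩ := h3 s
    have h5 := h s
    rw [h4, ← one_smul ℂ (orbitVec s m), cross_smul] at h5
    simpa [ha] using h5
  exact this ▸ h1

/-- The unitary multiple of `reflection t s`. -/
noncomputable def unitaryReflection (t s : ℝ) : Matrix (Fin 2) (Fin 2) ℂ :=
  ((√((1 + t ^ 2) ^ 2 * (1 + s ^ 2) / 4))⁻¹ : ℂ) • reflection t s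

theorem reflection_conjTranspose (t s : ℝ) : (reflection t s)ᴴ = reflection t s := by
  ext i j
  fin_cases i <;> fin_cases j <;>
    simp [reflection, Matrix.conjTranspose_apply, Complex.conj_ofReal] <;> ring

theorem unitaryReflection_conjTranspose_mul (t s : ℝ) :
    (unitaryReflection t s)ᴴ * unitaryReflection t s = 1 := by
  have h0 : (0 : ℝ) < (1 + t ^ 2) ^ 2 * (1 + s ^ 2) / 4 := by positivity
  rw [unitaryReflection, Matrix.conjTranspose_smul, reflection_conjTranspose, Matrix.smul_mul,
    Matrix.mul_smul, reflection_mul_self, smul_smul, smul_smul, reflectionSq_ofReal]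
  rw [star_inv₀, Complex.star_def, Complex.conj_ofReal]
  rw [← Complex.ofReal_inv, ← Complex.ofReal_mul, ← Complex.ofReal_mul]
  rw [mul_assoc, ← Real.mul_self_sqrt h0.le]
  simp only [Real.mul_self_sqrt h0.le]
  have : (√((1 + t ^ 2) ^ 2 * (1 + s ^ 2) / 4)) ≠ 0 := (Real.sqrt_pos.2 h0).ne'
  have h1 := Real.mul_self_sqrt h0.le
  rw [show (√((1 + t ^ 2) ^ 2 * (1 + s ^ 2) / 4))⁻¹ * ((√((1 + t ^ 2) ^ 2 * (1 + s ^ 2) / 4))⁻¹ *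
    ((1 + t ^ 2) ^ 2 * (1 + s ^ 2) / 4)) = 1 by
      field_simp
      linarith]
  simp

/-- A `2 × 2` matrix acting on the first two of `2 + k` levels. -/
noncomputable def extendLevels (k : ℕ) (A : Matrix (Fin 2) (Fin 2) ℂ) :
    Matrix (Fin (2 + k)) (Fin (2 + k)) ℂ :=
  Matrix.reindexAlgEquiv ℂ ℂ finSumFinEquiv (Matrix.fromBlocks A 0 0 1)

/-- The extension of a vector on the first two of `2 + k` levels by zero. -/
def extendVec (k : ℕ) (u : Fin 2 → ℂ) : Fin (2 + k) → ℂ :=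
  Sum.elim u 0 ∘ finSumFinEquiv.symm

theorem extendLevels_conjTranspose_mul {k : ℕ} {A : Matrix (Fin 2) (Fin 2) ℂ} (hA : Aᴴ * A = 1) :
    (extendLevels k A)ᴴ * extendLevels k A = 1 := by
  have : (extendLevels k A)ᴴ = extendLevels k Aᴴ := by
    simp [extendLevels, Matrix.fromBlocks_conjTranspose]
  rw [this, extendLevels, extendLevels, ← map_mul, Matrix.fromBlocks_multiply]
  simp [hA]

theorem extendLevels_mulVec (k : ℕ) (A : Matrix (Fin 2) (Fin 2) ℂ) (u : Fin 2 → ℂ) :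
    extendLevels k A *ᵥ extendVec k u = extendVec k (A *ᵥ u) := by
  rw [extendLevels, extendVec, Matrix.coe_reindexAlgEquiv, Matrix.reindex_apply,
    Matrix.submatrix_mulVec_equiv]
  simp only [Function.comp_assoc, Equiv.symm_symm, Equiv.symm_comp_self, Function.comp_id,
    Matrix.fromBlocks_mulVec, extendVec]
  congr 1
  ext (i | i) <;> simp

theorem dotProduct_extendVec (k : ℕ) (f u : Fin 2 → ℂ) :
    extendVec k f ⬝ᵥ extendVec k u = f ⬝ᵥ u := by
  rw [extendVec, extendVec, dotProduct_comp_equiv_symm]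
  simp [Function.comp_assoc]

theorem extendVec_single (k : ℕ) (h : 0 < 2 + k) :
    extendVec k ![1, 0] = Pi.single ⟨0, h⟩ 1 := by
  ext i
  refine Fin.addCases (fun j => ?_) (fun j => ?_) i
  · fin_cases j <;> simp [extendVec, Pi.single_apply, Fin.ext_iff]
  · simp [extendVec, Fin.ext_iff]

/-- If the state reached by the word `l` equals that of the word `p` of distinct letters, up to a
scalar and for all unitary gates, then `p` is a subsequence of `l`. -/
theorem sublist_of_forall_unitary {n d : ℕ} (hd : 2 ≤ d) {l p : List (Fin n)} (hp : p.Nodup)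
    (h : ∀ (V : Fin n → Matrix.unitaryGroup (Fin d) ℂ) (f : Fin d → ℂ),
      f ⬝ᵥ (((p.map V).reverse.prod : Matrix (Fin d) (Fin d) ℂ) *ᵥ
        Pi.single ⟨0, by omega⟩ 1) = 0 →
      f ⬝ᵥ (((l.map V).reverse.prod : Matrix (Fin d) (Fin d) ℂ) *ᵥ
        Pi.single ⟨0, by omega⟩ 1) = 0) : p.Sublist l := by
  obtain ⟨k, rfl⟩ := Nat.exists_eq_add_of_le hd
  set t : Fin n → ℝ := fun j => (j : ℝ) + 1 with ht
  have htinj : Function.Injective t := by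
    intro i j hij
    simp only [ht, add_left_inj, Nat.cast_inj] at hij
    exact Fin.ext hij
  have htpos : ∀ m : List (Fin n), ∀ x ∈ m.map t, 0 < x := by
    intro m x hx
    obtain ⟨j, -, rfl⟩ := List.mem_map.1 hx
    positivity
  suffices hsub : (p.reverse.map t).Sublist (l.reverse.map t) by
    rw [← List.reverse_sublist]
    obtain ⟨q, hq1, hq2⟩ := List.sublist_map_iff.1 hsub
    rwa [(List.map_injective_iff.2 htinj) hq2]
  have hchain : (p.reverse.map t).IsChain (· ≠ ·) := by
    refine List.Pairwise.isChain ?_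
    exact ((List.nodup_reverse.2 hp).map htinj)
  refine sublist_of_cross_orbitVec (htpos _) hchain (htpos _) fun s => ?_
  set V : Fin n → Matrix.unitaryGroup (Fin (2 + k)) ℂ := fun j =>
    ⟨extendLevels k (unitaryReflection (t j) s), Matrix.mem_unitaryGroup_iff'.2
      (extendLevels_conjTranspose_mul (unitaryReflection_conjTranspose_mul _ _))⟩ with hV
  have hprod : ∀ m : List (Fin n), ∃ a : ℂ, a ≠ 0 ∧
      ((m.map V).prod : Matrix (Fin (2 + k)) (Fin (2 + k)) ℂ) *ᵥ extendVec k ![1, 0] =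
        extendVec k (a • orbitVec s (m.map t)) := by
    intro m
    induction m with
    | nil => exact ⟨1, one_ne_zero, by simp [orbitVec]⟩
    | cons j m ih =>
      obtain ⟨a, ha, h1⟩ := ih
      refine ⟨a * ((√((1 + t j ^ 2) ^ 2 * (1 + s ^ 2) / 4))⁻¹ : ℂ), mul_ne_zero ha ?_, ?_⟩
      · rw [← Complex.ofReal_inv, Complex.ofReal_ne_zero]
        positivity
      · rw [List.map_cons, List.prod_cons, Submonoid.coe_mul, ← Matrix.mulVec_mulVec, h1]
        change extendLevels k (unitaryReflection (t j) s) *ᵥ _ = _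
        rw [extendLevels_mulVec, List.map_cons, orbitVec, unitaryReflection, Matrix.smul_mulVec,
          Matrix.mulVec_smul, smul_smul, mul_comm a]
  obtain ⟨a, ha, h1⟩ := hprod l.reverse
  obtain ⟨b, hb, h2⟩ := hprod p.reverse
  set w := orbitVec s (p.reverse.map t) with hw
  -- This covector pairs with a vector to give its determinant with `w`; in particular it kills `w`.
  have h3 := h V (extendVec k ![w 1, -w 0])
  rw [← List.map_reverse, ← List.map_reverse, ← extendVec_single, h1, h2, dotProduct_extendVec,
    dotProduct_extendVec] at h3
  simp only [dotProduct, Fin.sum_univ_two, Matrix.cons_val_zero, Matrix.cons_val_one,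
    Pi.smul_apply, smul_eq_mul] at h3
  have h4 := h3 (by ring)
  have h5 : a * cross (orbitVec s (l.reverse.map t)) w = 0 := by
    rw [← h4, cross]; ring
  exact (mul_eq_zero.1 h5).resolve_left ha

end Reflections

/-! ### Gates on one wire and covectors pulled back through them -/

section LocalGates

variable {ι : Type*} [Fintype ι] [DecidableEq ι] {d : ℕ}

/-- The matrix of the gate `V` on the wire `w`, tensored with the identity. -/
noncomputable def localMatrix (w : ι) (V : Matrix (Fin d) (Fin d) ℂ) :
    Matrix (ι → Fin d) (ι → Fin d) ℂ :=
  Matrix.of fun x y => if ∀ i, i ≠ w → x i = y i then V (x w) (y w) else 0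

theorem localMatrix_mulVec (w : ι) (V : Matrix (Fin d) (Fin d) ℂ) (ψ : (ι → Fin d) → ℂ)
    (x : ι → Fin d) :
    (localMatrix w V *ᵥ ψ) x = ∑ a, V (x w) a * ψ (Function.update x w a) := by
  rw [Matrix.mulVec, dotProduct]
  symm
  refine Fintype.sum_of_injective (Function.update x w) (Function.update_injective x w) _ _ ?_ ?_
  · intro y hy
    rw [localMatrix, Matrix.of_apply, if_neg, zero_mul]
    intro hxy
    refine hy ⟨y w, ?_⟩
    ext i
    by_cases hi : i = w
    · subst hi; simp
    · rw [Function.update_of_ne hi, hxy i hi]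
  · intro a
    rw [localMatrix, Matrix.of_apply, if_pos, Function.update_self]
    intro i hi
    rw [Function.update_of_ne hi]

theorem localMatrix_mul (w : ι) (A B : Matrix (Fin d) (Fin d) ℂ) :
    localMatrix w (A * B) = localMatrix w A * localMatrix w B := by
  ext x z
  change _ = (localMatrix w A *ᵥ fun y => localMatrix w B y z) x
  rw [localMatrix_mulVec]
  have h : ∀ a, (∀ i, i ≠ w → Function.update x w a i = z i) ↔ ∀ i, i ≠ w → x i = z i :=
    fun a => forall₂_congr fun i hi => by rw [Function.update_of_ne hi]
  simp only [localMatrix, Matrix.of_apply, h, Function.update_self, Matrix.mul_apply]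
  split_ifs <;> simp

theorem localMatrix_one (w : ι) :
    localMatrix w (1 : Matrix (Fin d) (Fin d) ℂ) = 1 := by
  ext x z
  rw [localMatrix, Matrix.of_apply, Matrix.one_apply, Matrix.one_apply, ← ite_and]
  congr 1
  rw [eq_iff_iff]
  constructor
  · rintro ⟨h1, h2⟩
    ext i
    by_cases hi : i = w
    · rw [hi, h2]
    · rw [h1 i hi]
  · rintro rfl
    exact ⟨fun _ _ => rfl, rfl⟩

theorem localMatrix_conjTranspose (w : ι) (V : Matrix (Fin d) (Fin d) ℂ) :
    (localMatrix w V)ᴴ = localMatrix w Vᴴ := by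
  ext x z
  simp only [localMatrix, Matrix.conjTranspose_apply, Matrix.of_apply, eq_comm (a := z _)]
  split_ifs <;> simp

/-- The gate `V` on the wire `w` as a unitary. -/
noncomputable def localUnitary (w : ι) (V : Matrix.unitaryGroup (Fin d) ℂ) :
    Matrix.unitaryGroup (ι → Fin d) ℂ :=
  ⟨localMatrix w V, Matrix.mem_unitaryGroup_iff'.2 (by
    have hV : (V : Matrix (Fin d) (Fin d) ℂ)ᴴ * V = 1 := Matrix.mem_unitaryGroup_iff'.1 V.2
    rw [Matrix.star_eq_conjTranspose, localMatrix_conjTranspose, ← localMatrix_mul, hV,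
      localMatrix_one])⟩

theorem coe_prod_map_localUnitary {n : ℕ} (w : ι) (V : Fin n → Matrix.unitaryGroup (Fin d) ℂ)
    (l : List (Fin n)) :
    ((l.map fun j => localUnitary w (V j)).prod : Matrix (ι → Fin d) (ι → Fin d) ℂ) =
      localMatrix w ((l.map V).prod : Matrix (Fin d) (Fin d) ℂ) := by
  induction l with
  | nil => exact (localMatrix_one w).symm
  | cons j l ih =>
    rw [List.map_cons, List.prod_cons, Submonoid.coe_mul, ih, List.map_cons, List.prod_cons,
      Submonoid.coe_mul, localMatrix_mul]
    rfl

/-- The covector `f`, applied to the wire `w`, kills the vector `ψ`. -/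
def Annihilates (w : ι) (f : Fin d → ℂ) (ψ : (ι → Fin d) → ℂ) : Prop :=
  ∀ x, ∑ a, f a * ψ (Function.update x w a) = 0

theorem Annihilates.of_localMatrix_self {w : ι} {f : Fin d → ℂ} {ψ : (ι → Fin d) → ℂ}
    {V : Matrix (Fin d) (Fin d) ℂ} (h : Annihilates w f (localMatrix w V *ᵥ ψ)) :
    Annihilates w (f ᵥ* V) ψ := by
  intro x
  rw [← h x]
  simp only [localMatrix_mulVec, Function.update_self, Function.update_idem, Matrix.vecMul,
    dotProduct, Finset.sum_mul, Finset.mul_sum]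
  rw [Finset.sum_comm]
  exact Finset.sum_congr rfl fun a _ => Finset.sum_congr rfl fun b _ => by ring

/-- The contraction on `w` commutes with the gate on `q`, and `V` is injective. -/
theorem Annihilates.of_localMatrix_ne {w q : ι} (hq : q ≠ w) {f : Fin d → ℂ}
    {ψ : (ι → Fin d) → ℂ} {V : Matrix (Fin d) (Fin d) ℂ} (hV : Vᴴ * V = 1)
    (h : Annihilates w f (localMatrix q V *ᵥ ψ)) : Annihilates w f ψ := by
  intro x
  set φ : Fin d → ℂ := fun a => ∑ b, f b * ψ (Function.update (Function.update x q a) w b) with hφ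
  have h0 : V *ᵥ φ = 0 := by
    ext c
    rw [Pi.zero_apply, ← h (Function.update x q c)]
    simp only [localMatrix_mulVec]
    simp only [Matrix.mulVec, dotProduct, hφ, Finset.mul_sum]
    rw [Finset.sum_comm]
    refine Finset.sum_congr rfl fun b _ => Finset.sum_congr rfl fun a _ => ?_
    rw [Function.update_of_ne hq, Function.update_self, Function.update_comm hq.symm,
      Function.update_idem]
    ring
  have h1 : φ = 0 := by
    rw [← Matrix.one_mulVec φ, ← hV, ← Matrix.mulVec_mulVec, h0, Matrix.mulVec_zero]
  have h2 := congrFun h1 (x q)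
  simpa only [hφ, Function.update_eq_self, Pi.zero_apply] using h2

end LocalGates

/-! ### From circuits to words containing all permutations -/

section Circuits

variable {n d r m : ℕ}

theorem rewireMatrix_mulVec (τ : Equiv.Perm (Fin n) → Equiv.Perm (Wire r m))
    (v : Basis n d r m → ℂ) (σ : Equiv.Perm (Fin n)) (x : Wire r m → Fin d) :
    (rewireMatrix τ *ᵥ v) (σ, x) = v (σ, x ∘ (τ σ).symm) := by
  rw [Matrix.mulVec, dotProduct, Fintype.sum_eq_single (σ, x ∘ (τ σ).symm)]
  · rw [rewireMatrix, Matrix.of_apply, if_pos, one_mul]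
    ext <;> simp
  · rintro ⟨σ', y⟩ hne
    rw [rewireMatrix, Matrix.of_apply, if_neg, zero_mul]
    rintro h
    rw [Prod.mk.injEq] at h
    obtain ⟨rfl, rfl⟩ := h
    exact hne (by ext <;> simp)

theorem applyMatrix_localMatrix_mulVec (V : Matrix (Fin d) (Fin d) ℂ) (i : Fin r)
    (e : Fin r ↪ Wire r m) (v : Basis n d r m → ℂ) (σ : Equiv.Perm (Fin n)) :
    (fun x => (applyMatrix (localMatrix i V) e *ᵥ v) (σ, x)) =
      localMatrix (e i) V *ᵥ fun x => v (σ, x) := by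
  ext x
  rw [localMatrix_mulVec, Matrix.mulVec, dotProduct]
  symm
  refine Fintype.sum_of_injective (fun a => ((σ, Function.update x (e i) a) : Basis n d r m))
    (fun a b hab => Function.update_injective x (e i) (Prod.mk.inj hab).2) _ _ ?_ ?_
  · rintro ⟨σ', y⟩ hy
    rw [applyMatrix, Matrix.of_apply]
    split_ifs with h
    · rw [localMatrix, Matrix.of_apply, if_neg, zero_mul]
      intro h2
      obtain ⟨h1, h3⟩ := h
      dsimp only at h1 h2 h3
      subst h1
      refine hy ⟨y (e i), ?_⟩
      rw [Prod.mk.injEq]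
      refine ⟨rfl, ?_⟩
      ext w
      by_cases hw : w = e i
      · subst hw; simp
      · rw [Function.update_of_ne hw]
        by_cases hr : w ∈ Set.range e
        · obtain ⟨k, rfl⟩ := hr
          rw [h2 k fun hk => hw (by rw [hk])]
        · rw [h3 w hr]
    · rw [zero_mul]
  · intro a
    rw [applyMatrix, Matrix.of_apply, if_pos, localMatrix, Matrix.of_apply, if_pos]
    · simp
    · intro k hk
      exact (Function.update_of_ne (fun h => hk (e.injective h)) a x).symm
    · refine ⟨rfl, fun w hw => ?_⟩
      have hne : w ≠ e i := by
        rintro rfl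
        exact hw ⟨i, rfl⟩
      exact (Function.update_of_ne hne a x).symm

/-- The oracles called by a list of gates, in order. -/
def calledOracles : List (Gate n r m) → List (Fin n)
  | [] => []
  | .rewire _ :: l => calledOracles l
  | .call j _ :: l => j :: calledOracles l

theorem length_calledOracles (l : List (Gate n r m)) :
    (calledOracles l).length = (l.map Gate.calls).sum := by
  induction l with
  | nil => rfl
  | cons g l ih => cases g <;> simp [calledOracles, Gate.calls, ih, Nat.add_comm]

/-- With oracles acting on one wire only, a wire at the end of the circuit is fed by one wire at
the beginning, through a subsequence of the calls. -/
theorem exists_source_wire (i : Fin r) (σ : Equiv.Perm (Fin n)) (w : Wire r m)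
    (gates : List (Gate n r m)) :
    ∃ (k : Wire r m) (l : List (Fin n)), l.Sublist (calledOracles gates) ∧
      ∀ (V : Fin n → Matrix.unitaryGroup (Fin d) ℂ) (v : Basis n d r m → ℂ) (f : Fin d → ℂ),
        Annihilates w f (fun x =>
          gates.foldl (fun v g => g.matrix (fun j => localUnitary i (V j)) *ᵥ v) v (σ, x)) →
        Annihilates k (f ᵥ* ((l.map V).reverse.prod : Matrix (Fin d) (Fin d) ℂ))
          (fun x => v (σ, x)) := by
  induction gates with
  | nil => exact ⟨w, [], List.Sublist.refl _, fun V v f h => by simpa using h⟩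
  | cons g gates ih =>
    obtain ⟨k, l, hl, h⟩ := ih
    cases g with
    | rewire τ =>
      refine ⟨τ σ k, l, hl, fun V v f hf => ?_⟩
      have h1 := h V _ f hf
      intro x
      rw [← h1 (x ∘ τ σ)]
      refine Finset.sum_congr rfl fun a _ => ?_
      change _ = _ * (rewireMatrix τ *ᵥ v) (σ, _)
      rw [rewireMatrix_mulVec]
      congr 3
      ext q
      simp [Function.update_apply, Equiv.symm_apply_eq]
    | call j e =>
      -- The oracles act as the identity on all their wires but the one in position `i`, so only
      -- calls with `e i = k` matter for the traced wire.
      by_cases hk : e i = k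
      · refine ⟨k, j :: l, hl.cons_cons j, fun V v f hf => ?_⟩
        have h1 := h V _ f hf
        simp only [Gate.matrix, localUnitary] at h1
        rw [applyMatrix_localMatrix_mulVec, hk] at h1
        have h2 := h1.of_localMatrix_self
        rwa [Matrix.vecMul_vecMul, ← Submonoid.coe_mul, ← List.prod_concat, List.concat_eq_append,
          ← List.reverse_cons, ← List.map_cons] at h2
      · refine ⟨k, l, hl.cons j, fun V v f hf => ?_⟩
        have h1 := h V _ f hf
        simp only [Gate.matrix, localUnitary] at h1
        rw [applyMatrix_localMatrix_mulVec] at h1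
        exact h1.of_localMatrix_ne hk (Matrix.mem_unitaryGroup_iff'.1 (V j).2)

theorem isState_single {B : Type} [Fintype B] [DecidableEq B] (b : B) :
    IsState (Pi.single b 1 : B → ℂ) := by
  rw [IsState, Fintype.sum_eq_single b]
  · simp
  · intro c hc
    simp [hc]

theorem localMatrix_mulVec_single (i : Fin r) (W : Matrix (Fin d) (Fin d) ℂ) (z x : Fin r → Fin d)
    (f : Fin d → ℂ) (h : f ⬝ᵥ (W *ᵥ Pi.single (z i) 1) = 0) :
    ∑ a, f a * (localMatrix i W *ᵥ Pi.single z 1) (Function.update x i a) = 0 := by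
  simp only [Matrix.mulVec_single_one, Matrix.col_apply, dotProduct] at h ⊢
  by_cases hx : ∀ k, k ≠ i → x k = z k
  · rw [← h]
    refine Finset.sum_congr rfl fun a _ => ?_
    rw [localMatrix, Matrix.of_apply, if_pos, Function.update_self]
    intro k hk
    rw [Function.update_of_ne hk, hx k hk]
  · refine Finset.sum_eq_zero fun a _ => ?_
    rw [localMatrix, Matrix.of_apply, if_neg, mul_zero]
    refine fun hcon => hx fun k hk => ?_
    rw [← hcon k hk, Function.update_of_ne hk]

/-- The calls of a circuit solving the unitary permutation problem contain every permutation as a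
subsequence. -/
theorem ofFn_sublist_calledOracles (hd : 2 ≤ d) (hr : 1 ≤ r) (C : Circuit n d r)
    (hC : C.SolvesUP) (σ : Equiv.Perm (Fin n)) :
    (List.ofFn σ).Sublist (calledOracles C.gates) := by
  set i : Fin r := ⟨0, hr⟩ with hi
  obtain ⟨k, l, hl, h⟩ := exists_source_wire (d := d) i σ (Sum.inl i) C.gates
  have key : ∀ (V : Fin n → Matrix.unitaryGroup (Fin d) ℂ) (z : Fin r → Fin d) (f : Fin d → ℂ),
      f ⬝ᵥ ((((List.ofFn σ).map V).reverse.prod : Matrix (Fin d) (Fin d) ℂ) *ᵥ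
        Pi.single (z i) 1) = 0 →
      Annihilates k (f ᵥ* ((l.map V).reverse.prod : Matrix (Fin d) (Fin d) ℂ))
        (fun x => (tensorState σ (Pi.single z 1) C.ancilla : Basis n d r C.m → ℂ) (σ, x)) := by
    intro V z f hf
    refine h V _ f ?_
    obtain ⟨χ, -, hχ⟩ := hC (fun j => localUnitary i (V j)) σ (Pi.single z 1) (isState_single z)
    rw [Circuit.run] at hχ
    rw [hχ]
    have hord : ((orderedProduct (fun j => localUnitary i (V j)) σ :
        Matrix.unitaryGroup (Fin r → Fin d) ℂ) : Matrix (Fin r → Fin d) (Fin r → Fin d) ℂ) =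
        localMatrix i (((List.ofFn σ).map V).reverse.prod : Matrix (Fin d) (Fin d) ℂ) := by
      rw [← List.map_reverse, ← coe_prod_map_localUnitary, List.map_reverse, List.map_ofFn]
      rfl
    rw [hord]
    intro x
    have h1 := localMatrix_mulVec_single i _ z (fun q => x (Sum.inl q)) f hf
    have h2 : ∀ a, (fun q => Function.update x (Sum.inl i) a (Sum.inl q)) =
        Function.update (fun q => x (Sum.inl q)) i a := by
      intro a
      ext q
      simp [Function.update_apply]
    have h3 : ∀ a, (fun q => Function.update x (Sum.inl i) a (Sum.inr q)) =
        fun q => x (Sum.inr q) := by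
      intro a
      ext q
      simp
    simp only [tensorState, if_true, h2, h3, ← mul_assoc]
    rw [← Finset.sum_mul, h1, zero_mul]
  obtain ⟨y₀, hy₀⟩ : ∃ y, C.ancilla y ≠ 0 := by
    by_contra! hcon
    have := C.isState_ancilla
    simp [IsState, hcon] at this
  refine List.Sublist.trans ?_ hl
  cases k with
  | inl k =>
    refine sublist_of_forall_unitary hd (List.nodup_ofFn.2 σ.injective) fun V f hf => ?_
    -- All data wires start in the same basis state, so the source `k` need not be the wire `i`.
    set z : Fin r → Fin d := fun _ => ⟨0, by omega⟩ with hz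
    have h1 := key V z f hf (Sum.elim z y₀)
    rw [Fintype.sum_eq_single ⟨0, by omega⟩] at h1
    · have h2 : Function.update (Sum.elim z y₀) (Sum.inl k) ⟨0, by omega⟩ = Sum.elim z y₀ :=
        Function.update_eq_self_iff.2 rfl
      rw [h2] at h1
      simp only [tensorState, if_true, Sum.elim_inl, Sum.elim_inr, Pi.single_eq_same, one_mul,
        mul_eq_zero, hy₀, or_false] at h1
      rw [Matrix.dotProduct_mulVec, dotProduct_single, mul_one]
      exact h1
    · intro a ha
      have h2 : (fun q => Function.update (Sum.elim z y₀) (Sum.inl k) a (Sum.inl q)) ≠ z := by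
        intro hcon
        have := congrFun hcon k
        rw [Function.update_self] at this
        exact ha this
      refine mul_eq_zero_of_right _ ?_
      dsimp only [tensorState]
      rw [if_pos rfl]
      exact mul_eq_zero_of_left (Pi.single_eq_of_ne h2 _) _
  | inr k =>
    exfalso
    -- An ancillary source is impossible: with trivial oracles and data `b`, the output is killed by
    -- the covector at `y₀ k`, but the ancilla has a nonzero amplitude there.
    obtain ⟨b, hb⟩ : ∃ b : Fin d, y₀ k ≠ b := ⟨if y₀ k = ⟨0, by omega⟩ then ⟨1, by omega⟩ else
      ⟨0, by omega⟩, by split_ifs with h0 <;> simp [h0]⟩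
    have hone : ∀ q : List (Fin n),
        ((q.map fun _ => (1 : Matrix.unitaryGroup (Fin d) ℂ)).reverse.prod :
          Matrix (Fin d) (Fin d) ℂ) = 1 := by
      intro q
      simp
    set z : Fin r → Fin d := fun _ => b with hz
    have h1 := key (fun _ => 1) z (Pi.single (y₀ k) 1)
      (by rw [hone]; simp [hz, hb]) (Sum.elim z y₀)
    rw [hone, Matrix.vecMul_one, Fintype.sum_eq_single (y₀ k)] at h1
    · have h2 : Function.update (Sum.elim z y₀) (Sum.inr k) (y₀ k) = Sum.elim z y₀ :=
        Function.update_eq_self_iff.2 rfl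
      rw [h2] at h1
      simp [tensorState, hy₀] at h1
    · intro a ha
      rw [Pi.single_eq_of_ne ha, zero_mul]

end Circuits

end UnitaryPermutation

theorem mainTheorem3 (ε : ℝ) (hε : 0 < ε) :
    ∃ f : ℕ → ℝ, f =o[atTop] (fun n : ℕ => (n : ℝ) ^ (7 / 4 + ε : ℝ)) ∧
      ∀ (n d r : ℕ), 2 ≤ d → 1 ≤ r → ∀ C : UnitaryPermutation.Circuit n d r,
        C.SolvesUP → (n : ℝ) ^ 2 - f n ≤ (C.calls : ℝ) := by
  obtain ⟨f, hf, h⟩ := UnitaryPermutation.exists_length_lower_bound ε hε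
  refine ⟨f, hf, fun n d r hd hr C hC => ?_⟩
  rw [UnitaryPermutation.Circuit.calls, ← UnitaryPermutation.length_calledOracles]
  exact h n _ (UnitaryPermutation.ofFn_sublist_calledOracles hd hr C hC)
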